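/- **Conventions.** A graph over alphabets $\Sigma,\Gamma$ is a finite directed graph without self-loops, with node labels in $\Sigma$ and a set of edges $E\subseteq\{(v,\gamma,w): v\neq w\}$ labelled in $\Gamma$. A *string graph* is such a graph with node labels $\{N,W\}$ (node-vertices, wire-vertices) and one edge label, in which no edge joins two node-vertices and every wire-vertex has in-degree and out-degree at most one; its inputs (outputs) are the wire-vertices without incoming (outgoing) edges. A full subgraph $O\subseteq H$ is *open* if $\mathrm{In}(H\setminus O)\subseteq \mathrm{In}(H)$ and $\mathrm{Out}(H\setminus O)\subseteq \mathrm{Out}(H)$. A *!-graph* $H$ is a string graph with a finite poset $!(H)$ of *!-boxes* and an open subgraph $B(b)\subseteq H$ for each $b\in{!(H)}$, such that $b\le b'$ implies $B(b)\subseteq B(b')$. $\mathrm{KILL}_b(H)$ is obtained by removing $B(b)$ and all !-boxes $c\le b$; $\mathrm{EXPAND}_b(H)=H\sqcup_{\mathrm{KILL}_b(H)}H'$, where $H'$ is a copy of $H$ in which $b$ is no longer a !-box, so that a new copy of the contents of $b$ is created, together with new copies of the !-boxes strictly below $b$. The *language* of $H$ is the set of string graphs, up to isomorphism, that are obtained from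 $H$ by a finite sequence of these operations and have no !-boxes left. Two !-boxes *overlap* if they are incomparable and $B(b_1)\cap B(b_2)\neq\emptyset$. An *edNCE grammar* $(\Sigma,\Delta,\Gamma,\Omega,P,S)$ has a finite set $P$ of productions $X\to(D,C)$ with $X\in\Sigma\setminus\Delta$ a nonterminal, $D$ a graph over $\Sigma,\Gamma$ and $C\subseteq\Sigma\times\Gamma\times\Gamma\times V_D\times\{in,out\}$. Such a production rewrites a node $v$ labelled $X$: $v$ is replaced by a fresh copy of $D$, and for $(\sigma,\beta/\gamma,x,in)\in C$ (resp. $out$) and every $\beta$-labelled edge from a $\sigma$-labelled node $w$ to $v$ (resp. from $v$ to $w$) a $\gamma$-labelled edge from $w$ to $x$ (resp. from $x$ to $w$) is added. The language of the grammar is the set of isomorphism classes of graphs over the terminal node labels $\Delta$ and the final edge labels $\Omega$ that are derivable from the one-node graph labelled $S$; here $\Delta=\{N,W\}$ and $\Omega$ consists of the edge label of string graphs. *Sentential forms* are the graphs derivable from the start graph. The grammar is *LIN-edNCE* if every right-hand side has at most one nonterminal node; a production is *final* if its right-hand side has none. Let $v_1,\dots,v_n$ be the vertices of $H$. A grammar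 is in *!-linear form* (with respect to distinct non-final edge labels $\alpha_1,\dots,\alpha_n$) if 1. it is a LIN-edNCE grammar; 2. it has exactly one final production, and the right-hand side of this production is the empty graph; 3. in every sentential form with a nonterminal node, every terminal node is joined to the nonterminal node by edges in both directions with the same label $\alpha_i$ for some $i$, and every edge between a terminal node and the nonterminal node has some $\alpha_i$ as its label; 4. every production except the final one has connection instructions by which, for each $i$, both the incoming and the outgoing edges labelled $\alpha_i$ between the replaced node and terminal nodes are connected to the nonterminal node of the right-hand side (the new edges being labelled by some $\alpha_k$); 5. for every $i$, at most one terminal node in all the right-hand sides of productions is incident to an edge labelled $\alpha_i$. **Theorem.** For every !-graph $H$ without overlapping !-boxes there is a LIN-edNCE grammar in !-linear form whose language is the language of $H$. The grammar can be constructed effectively: there is a computable function which maps every finite description of such an $H$ to a finite description of such a grammar. -/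

import Mathlib

/-! ### Labelled graphs -/

/-- A finite directed graph without self-loops, with vertex labels in `S` and edge labels in `L`.
`E v γ w` says that `(v, γ, w)` is an edge. -/
structure LGraph (S L : Type) where
  V : Type
  finite_V : Finite V
  E : V → L → V → Prop
  irrefl : ∀ v γ, ¬ E v γ v
  lab : V → S

namespace LGraph

variable {S L : Type}

/-- Isomorphism of labelled graphs. -/
def IsoTo (H K : LGraph S L) : Prop :=
  ∃ e : H.V ≃ K.V, (∀ v, K.lab (e v) = H.lab v) ∧
    ∀ v γ w, K.E (e v) γ (e w) ↔ H.E v γ w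

/-- The full subgraph on a set of vertices. -/
def induce (H : LGraph S L) (s : Set H.V) : LGraph S L where
  V := s
  finite_V := by have := H.finite_V; infer_instance
  E v γ w := H.E v γ w
  irrefl v γ := H.irrefl v γ
  lab v := H.lab v

/-- The disjoint union of two copies of `H`, with the full subgraphs on the complement of `O`
identified. The vertices `Sum.inr v`, `v ∈ O`, are the second copy of `O`. -/
def double (H : LGraph S L) (O : Set H.V) : LGraph S L where
  V := H.V ⊕ O
  finite_V := by have := H.finite_V; infer_instance
  E x γ y := match x, y with
    | Sum.inl u, Sum.inl v => H.E u γ v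
    | Sum.inr u, Sum.inr v => H.E u γ v
    | Sum.inl u, Sum.inr v => u ∉ O ∧ H.E u γ v
    | Sum.inr u, Sum.inl v => v ∉ O ∧ H.E u γ v
  irrefl x γ := by
    rcases x with u | u
    · exact H.irrefl u γ
    · exact H.irrefl u γ
  lab x := match x with
    | Sum.inl u => H.lab u
    | Sum.inr u => H.lab u

/-- Regard a graph over alphabets `S`, `L` as a graph over larger alphabets. -/
def extend (S' L' : Type) (H : LGraph S L) : LGraph (S ⊕ S') (L ⊕ L') where
  V := H.V
  finite_V := H.finite_V
  E v γ w := ∃ l, γ = Sum.inl l ∧ H.E v l w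
  irrefl v γ := by
    rintro ⟨l, -, h⟩
    exact H.irrefl v l h
  lab v := Sum.inl (H.lab v)

end LGraph

/-! ### String graphs -/

/-- The two vertex labels of string graphs: node-vertices and wire-vertices. -/
inductive VKind where
  | node
  | wire

/-- Graphs with vertices labelled by `VKind` and edges carrying the one label `()`. -/
abbrev KGraph : Type 1 := LGraph VKind Unit

namespace KGraph

/-- No edge joins two node-vertices; wire-vertices have in-degree and out-degree at most one. -/
structure IsStringGraph (G : KGraph) : Prop where
  node_node : ∀ v w, G.lab v = VKind.node → G.lab w = VKind.node → ¬ G.E v () w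
  in_degree : ∀ w, G.lab w = VKind.wire → ∀ u v, G.E u () w → G.E v () w → u = v
  out_degree : ∀ w, G.lab w = VKind.wire → ∀ u v, G.E w () u → G.E w () v → u = v

/-- A wire-vertex without incoming edges. -/
def IsInput (G : KGraph) (v : G.V) : Prop :=
  G.lab v = VKind.wire ∧ ∀ u, ¬ G.E u () v

/-- A wire-vertex without outgoing edges. -/
def IsOutput (G : KGraph) (v : G.V) : Prop :=
  G.lab v = VKind.wire ∧ ∀ u, ¬ G.E v () u

/-- The full subgraph on `O` is open: `In(G \ O) ⊆ In(G)` and `Out(G \ O) ⊆ Out(G)`. -/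
structure IsOpenSub (G : KGraph) (O : Set G.V) : Prop where
  input : ∀ v : (LGraph.induce G Oᶜ).V, IsInput (LGraph.induce G Oᶜ) v → IsInput G v.1
  output : ∀ v : (LGraph.induce G Oᶜ).V, IsOutput (LGraph.induce G Oᶜ) v → IsOutput G v.1

theorem IsOpenSub.in_mem {G : KGraph} {O : Set G.V} (h : IsOpenSub G O) {u w : G.V}
    (hG : IsStringGraph G) (hw : G.lab w = VKind.wire) (hu : u ∈ O) (he : G.E u () w) :
    w ∈ O := by
  by_contra hwO
  have := h.input ⟨w, hwO⟩ ⟨hw, fun x hx => x.2 (by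
    have : x.1 = u := hG.in_degree w hw _ _ hx he
    exact this ▸ hu)⟩
  exact this.2 u he

theorem IsOpenSub.out_mem {G : KGraph} {O : Set G.V} (h : IsOpenSub G O) {u w : G.V}
    (hG : IsStringGraph G) (hw : G.lab w = VKind.wire) (hu : u ∈ O) (he : G.E w () u) :
    w ∈ O := by
  by_contra hwO
  have := h.output ⟨w, hwO⟩ ⟨hw, fun x hx => x.2 (by
    have : x.1 = u := hG.out_degree w hw _ _ hx he
    exact this ▸ hu)⟩
  exact this.2 u he

/-- In a string graph, openness says that a wire-vertex adjacent to `O` lies in `O`. -/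
theorem isOpenSub_of {G : KGraph} {O : Set G.V}
    (h1 : ∀ u w, G.lab w = VKind.wire → u ∈ O → G.E u () w → w ∈ O)
    (h2 : ∀ u w, G.lab w = VKind.wire → u ∈ O → G.E w () u → w ∈ O) : IsOpenSub G O where
  input v hv := ⟨hv.1, fun u hu => by
    by_cases huO : u ∈ O
    · exact v.2 (h1 u v.1 hv.1 huO hu)
    · exact hv.2 ⟨u, huO⟩ hu⟩
  output v hv := ⟨hv.1, fun u hu => by
    by_cases huO : u ∈ O
    · exact v.2 (h2 u v.1 hv.1 huO hu)
    · exact hv.2 ⟨u, huO⟩ hu⟩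

theorem IsStringGraph.induce {G : KGraph} (hG : IsStringGraph G) (s : Set G.V) :
    IsStringGraph (LGraph.induce G s) where
  node_node v w hv hw := hG.node_node v.1 w.1 hv hw
  in_degree w hw u v hu hv := Subtype.ext (hG.in_degree w.1 hw u.1 v.1 hu hv)
  out_degree w hw u v hu hv := Subtype.ext (hG.out_degree w.1 hw u.1 v.1 hu hv)

theorem IsStringGraph.double {G : KGraph} (hG : IsStringGraph G) {O : Set G.V}
    (hO : IsOpenSub G O) : IsStringGraph (LGraph.double G O) where
  node_node v w hv hw he := by
    rcases v with v | v <;> rcases w with w | w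
    · exact hG.node_node v w hv hw he
    · exact hG.node_node v w hv hw he.2
    · exact hG.node_node v w hv hw he.2
    · exact hG.node_node v w hv hw he
  in_degree w hw u v hu hv := by
    rcases w with w | w
    · rcases u with u | u <;> rcases v with v | v
      · exact congrArg Sum.inl (hG.in_degree w hw u v hu hv)
      · exact absurd (hO.in_mem hG hw v.2 hv.2) hv.1
      · exact absurd (hO.in_mem hG hw u.2 hu.2) hu.1
      · exact congrArg Sum.inr (Subtype.ext (hG.in_degree w hw u v hu.2 hv.2))
    · rcases u with u | u <;> rcases v with v | v
      · exact congrArg Sum.inl (hG.in_degree w hw u v hu.2 hv.2)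
      · exact absurd (hG.in_degree w hw u v hu.2 hv ▸ v.2) hu.1
      · exact absurd (hG.in_degree w hw u v hu hv.2 ▸ u.2) hv.1
      · exact congrArg Sum.inr (Subtype.ext (hG.in_degree w hw u v hu hv))
  out_degree w hw u v hu hv := by
    rcases w with w | w
    · rcases u with u | u <;> rcases v with v | v
      · exact congrArg Sum.inl (hG.out_degree w hw u v hu hv)
      · exact absurd (hO.out_mem hG hw v.2 hv.2) hv.1
      · exact absurd (hO.out_mem hG hw u.2 hu.2) hu.1
      · exact congrArg Sum.inr (Subtype.ext (hG.out_degree w hw u v hu.2 hv.2))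
    · rcases u with u | u <;> rcases v with v | v
      · exact congrArg Sum.inl (hG.out_degree w hw u v hu.2 hv.2)
      · exact absurd (hG.out_degree w hw u v hu.2 hv ▸ v.2) hu.1
      · exact absurd (hG.out_degree w hw u v hu hv.2 ▸ u.2) hv.1
      · exact congrArg Sum.inr (Subtype.ext (hG.out_degree w hw u v hu hv))

end KGraph

/-! ### !-graphs -/

/-- A !-graph: a string graph, a finite partially ordered set of !-boxes, and for every !-box an
open full subgraph (given by its vertex set), monotone in the !-box. -/
structure BangGraph where
  graph : KGraph
  isString : KGraph.IsStringGraph graph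
  Box : Type
  finite_Box : Finite Box
  order : PartialOrder Box
  content : Box → Set graph.V
  isOpen : ∀ b, KGraph.IsOpenSub graph (content b)
  mono : ∀ b b', b ≤ b' → content b ⊆ content b'

namespace BangGraph

attribute [instance] BangGraph.order

/-- `KILL_b`: remove `b`, the !-boxes nested in `b`, and the contents of `b`. -/
def kill (G : BangGraph) (b : G.Box) : BangGraph where
  graph := G.graph.induce (G.content b)ᶜ
  isString := G.isString.induce _
  Box := {c : G.Box // ¬ c ≤ b}
  finite_Box := by have := G.finite_Box; infer_instance
  order := inferInstance
  content c := {v | v.1 ∈ G.content c.1}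
  isOpen c := KGraph.isOpenSub_of
    (fun _ _ hw hu he => (G.isOpen c.1).in_mem G.isString hw hu he)
    (fun _ _ hw hu he => (G.isOpen c.1).out_mem G.isString hw hu he)
  mono c c' h _ hv := G.mono c.1 c'.1 h hv

/-- The !-boxes of `EXPAND_b(G)`: those of `G`, and a fresh copy of each !-box strictly nested
in `b`. -/
def ExpandBox (G : BangGraph) (b : G.Box) : Type := G.Box ⊕ {c : G.Box // c < b}

/-- The fresh copies are ordered among themselves and with respect to the !-boxes of `G` that are
not nested in `b` as the originals are, and are unrelated to `b` and the !-boxes nested in it. -/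
def expandOrder (G : BangGraph) (b : G.Box) : PartialOrder (G.ExpandBox b) where
  le x y := match x, y with
    | Sum.inl c, Sum.inl d => c ≤ d
    | Sum.inr c, Sum.inr d => c.1 ≤ d.1
    | Sum.inr c, Sum.inl d => c.1 ≤ d ∧ ¬ d ≤ b
    | Sum.inl _, Sum.inr _ => False
  le_refl x := by rcases x with c | c <;> exact le_refl _
  le_trans x y z hxy hyz := by
    rcases x with x | x <;> rcases y with y | y <;> rcases z with z | z
    · exact le_trans (α := G.Box) hxy hyz
    · exact hyz
    · exact hxy.elim
    · exact hxy
    · exact ⟨le_trans (α := G.Box) hxy.1 hyz, fun h => hxy.2 (le_trans (α := G.Box) hyz h)⟩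
    · exact hyz.elim
    · exact ⟨le_trans (α := G.Box) hxy hyz.1, hyz.2⟩
    · exact le_trans (α := G.Box) hxy hyz
  le_antisymm x y hxy hyx := by
    rcases x with x | x <;> rcases y with y | y
    · exact congrArg Sum.inl (le_antisymm (α := G.Box) hxy hyx)
    · exact hxy.elim
    · exact hyx.elim
    · exact congrArg Sum.inr (Subtype.ext (le_antisymm (α := G.Box) hxy hyx))

/-- `EXPAND_b`: glue to `G`, along `KILL_b(G)`, a second copy of `G` in which `b` is no longer a
!-box. The second copy of the contents of `b` comes with copies of the !-boxes strictly nested in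
`b`, and belongs to a !-box of `KILL_b(G)` whenever the original does. -/
def expand (G : BangGraph) (b : G.Box) : BangGraph where
  graph := G.graph.double (G.content b)
  isString := G.isString.double (G.isOpen b)
  Box := G.ExpandBox b
  finite_Box := by
    have := G.finite_Box
    exact inferInstanceAs (Finite (G.Box ⊕ {c : G.Box // c < b}))
  order := G.expandOrder b
  content x := {z | match x, z with
    | Sum.inl c, Sum.inl v => v ∈ G.content c
    | Sum.inl c, Sum.inr v => ¬ c ≤ b ∧ v.1 ∈ G.content c
    | Sum.inr _, Sum.inl _ => False
    | Sum.inr c, Sum.inr v => v.1 ∈ G.content c.1}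
  isOpen x := by
    apply KGraph.isOpenSub_of
    · intro u w hw hu he
      rcases x with c | c <;> rcases u with u | u <;> rcases w with w | w
      · exact (G.isOpen c).in_mem G.isString hw hu he
      · refine ⟨fun hc => he.1 (G.mono c b hc hu), (G.isOpen c).in_mem G.isString hw hu he.2⟩
      · exact absurd ((G.isOpen b).in_mem G.isString hw u.2 he.2) he.1
      · exact ⟨hu.1, (G.isOpen c).in_mem G.isString hw hu.2 he⟩
      · exact hu.elim
      · exact hu.elim
      · exact absurd ((G.isOpen b).in_mem G.isString hw u.2 he.2) he.1
      · exact (G.isOpen c.1).in_mem G.isString hw hu he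
    · intro u w hw hu he
      rcases x with c | c <;> rcases u with u | u <;> rcases w with w | w
      · exact (G.isOpen c).out_mem G.isString hw hu he
      · refine ⟨fun hc => he.1 (G.mono c b hc hu), (G.isOpen c).out_mem G.isString hw hu he.2⟩
      · exact absurd ((G.isOpen b).out_mem G.isString hw u.2 he.2) he.1
      · exact ⟨hu.1, (G.isOpen c).out_mem G.isString hw hu.2 he⟩
      · exact hu.elim
      · exact hu.elim
      · exact absurd ((G.isOpen b).out_mem G.isString hw u.2 he.2) he.1
      · exact (G.isOpen c.1).out_mem G.isString hw hu he
  mono x y hxy z hz := by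
    rcases x with c | c <;> rcases y with d | d <;> rcases z with v | v
    · exact G.mono c d hxy hz
    · exact ⟨fun hd => hz.1 (le_trans (α := G.Box) hxy hd), G.mono c d hxy hz.2⟩
    · exact hxy.elim
    · exact hxy.elim
    · exact hz.elim
    · exact ⟨hxy.2, G.mono c.1 d hxy.1 hz⟩
    · exact hz.elim
    · exact G.mono c.1 d.1 hxy hz

/-- `Reaches G G'`: `G'` is obtained from `G` by a finite sequence of !-box operations. -/
inductive Reaches (G : BangGraph) : BangGraph → Prop where
  | refl : Reaches G G
  | kill (K : BangGraph) (b : K.Box) : Reaches G K → Reaches G (K.kill b)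
  | expand (K : BangGraph) (b : K.Box) : Reaches G K → Reaches G (K.expand b)

/-- A !-graph without !-boxes. -/
def IsConcrete (G : BangGraph) : Prop := IsEmpty G.Box

/-- The language of a !-graph: all concrete graphs, up to isomorphism, obtained from it by
!-box operations. -/
def language (G : BangGraph) : Set KGraph :=
  {K | ∃ G' : BangGraph, Reaches G G' ∧ G'.IsConcrete ∧ G'.graph.IsoTo K}

/-- Two !-boxes overlap if neither is nested in the other and their contents meet. -/
def Overlapping (G : BangGraph) (b₁ b₂ : G.Box) : Prop :=
  ¬ b₁ ≤ b₂ ∧ ¬ b₂ ≤ b₁ ∧ (G.content b₁ ∩ G.content b₂).Nonempty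

def NoOverlap (G : BangGraph) : Prop := ∀ b₁ b₂, ¬ G.Overlapping b₁ b₂

end BangGraph

/-! ### edNCE graph grammars -/

inductive EdgeDir where
  | incoming
  | outgoing

/-- A graph with embedding. `C σ β γ x d` says that `(σ, β/γ, x, d)` is a connection
instruction. -/
structure EGraph (S L : Type) extends LGraph S L where
  C : S → L → L → V → EdgeDir → Prop

namespace EGraph

variable {S L : Type}

/-- The substitution `H[v/D]`; its vertices are the disjoint union of the vertices of `H` other
than `v` and those of `D`. -/
def subst (H : EGraph S L) (v : H.V) (D : EGraph S L) : EGraph S L where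
  V := {u : H.V // u ≠ v} ⊕ D.V
  finite_V := by have := H.finite_V; have := D.finite_V; infer_instance
  E x γ y := match x, y with
    | Sum.inl u, Sum.inl w => H.E u γ w
    | Sum.inr u, Sum.inr w => D.E u γ w
    | Sum.inl w, Sum.inr u => ∃ β, H.E w β v ∧ D.C (H.lab w) β γ u EdgeDir.incoming
    | Sum.inr u, Sum.inl w => ∃ β, H.E v β w ∧ D.C (H.lab w) β γ u EdgeDir.outgoing
  irrefl x γ := by
    rcases x with u | u
    · exact H.irrefl u γ
    · exact D.irrefl u γ
  lab x := match x with
    | Sum.inl u => H.lab u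
    | Sum.inr u => D.lab u
  C σ β δ x d := match x with
    | Sum.inl u => H.C σ β δ u d
    | Sum.inr u => ∃ γ, H.C σ β γ v d ∧ D.C σ γ δ u d

/-- The graph with one node, labelled `X`, no edges and no connection instructions. -/
def single (X : S) : EGraph S L where
  V := Unit
  finite_V := inferInstance
  E _ _ _ := False
  irrefl _ _ h := h
  lab _ := X
  C _ _ _ _ _ := False

end EGraph

/-- An edNCE grammar with terminal node labels `T` and final edge labels `F`. Its node labels are
`T ⊕ NT`, with `NT` the nonterminals, and its edge labels are `F ⊕ NF`, with `NF` the non-final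
edge labels. The productions `lhs p → rhs p` are indexed by a finite type. -/
structure EdNCE (T F : Type) where
  NT : Type
  finite_NT : Finite NT
  NF : Type
  finite_NF : Finite NF
  start : NT
  Prd : Type
  finite_Prd : Finite Prd
  lhs : Prd → NT
  rhs : Prd → EGraph (T ⊕ NT) (F ⊕ NF)

namespace EdNCE

variable {T F : Type}

/-- `Derives 𝒢 H`: the starting graph of `𝒢` derives `H`, i.e. `H` is a sentential form. -/
inductive Derives (𝒢 : EdNCE T F) : EGraph (T ⊕ 𝒢.NT) (F ⊕ 𝒢.NF) → Prop where
  | start : Derives 𝒢 (EGraph.single (Sum.inr 𝒢.start))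
  | step (H : EGraph (T ⊕ 𝒢.NT) (F ⊕ 𝒢.NF)) (v : H.V) (p : 𝒢.Prd) :
      Derives 𝒢 H → H.lab v = Sum.inr (𝒢.lhs p) → Derives 𝒢 (H.subst v (𝒢.rhs p))

/-- The graphs over `T`, `F` that are isomorphic to a graph derived from the starting graph. -/
def language (𝒢 : EdNCE T F) : Set (LGraph T F) :=
  {K | ∃ H, 𝒢.Derives H ∧ H.toLGraph.IsoTo (K.extend 𝒢.NT 𝒢.NF)}

/-- LIN-edNCE: every right-hand side has at most one nonterminal node. -/
def IsLinear (𝒢 : EdNCE T F) : Prop :=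
  ∀ p, {x : (𝒢.rhs p).V | ((𝒢.rhs p).lab x).isRight}.Subsingleton

/-- A production is final if its right-hand side has no nonterminal node. -/
def IsFinal (𝒢 : EdNCE T F) (p : 𝒢.Prd) : Prop :=
  ∀ x, ((𝒢.rhs p).lab x).isLeft

/-- The !-linear form, with respect to the non-final edge labels `α i`. -/
structure IsBangLinear (𝒢 : EdNCE T F) {ι : Type} (α : ι ↪ 𝒢.NF) : Prop where
  linear : 𝒢.IsLinear
  final_unique : ∃! p, 𝒢.IsFinal p
  final_empty : ∀ p, 𝒢.IsFinal p → IsEmpty (𝒢.rhs p).V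
  /-- Each terminal node of a sentential form is joined to the nonterminal node by edges in both
  directions with some label `α i` -/
  sentential : ∀ H, 𝒢.Derives H → ∀ x v, (H.lab x).isRight → (H.lab v).isLeft →
    ∃ i, H.E v (Sum.inr (α i)) x ∧ H.E x (Sum.inr (α i)) v
  /-- and no edge between them has any other label. -/
  sentential_label : ∀ H, 𝒢.Derives H → ∀ x v γ, (H.lab x).isRight → (H.lab v).isLeft →
    (H.E v γ x ∨ H.E x γ v) → ∃ i, γ = Sum.inr (α i)
  /-- In every production but the final one, the connection instructions connect incoming and
  outgoing edges labelled `α i`, for each `i`, to the nonterminal node of the right-hand side. The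
  new edges are again labelled by some `α k`. -/
  connect : ∀ p, ¬ 𝒢.IsFinal p → ∀ x, ((𝒢.rhs p).lab x).isRight →
    ∀ i, ∃ k, ∀ (σ : T) (d : EdgeDir),
      (𝒢.rhs p).C (Sum.inl σ) (Sum.inr (α i)) (Sum.inr (α k)) x d
  /-- Among all terminal nodes of all right-hand sides, at most one is incident to an edge
  labelled `α i`. -/
  incident : ∀ i, {z : (p : 𝒢.Prd) × (𝒢.rhs p).V | ((𝒢.rhs z.1).lab z.2).isLeft ∧
    ∃ u, (𝒢.rhs z.1).E z.2 (Sum.inr (α i)) u ∨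
      (𝒢.rhs z.1).E u (Sum.inr (α i)) z.2}.Subsingleton

end EdNCE

/-! ### Finite descriptions, for effectiveness -/

/-- `true` stands for a node-vertex and `false` for a wire-vertex. -/
def VKind.ofBool : Bool → VKind
  | true => VKind.node
  | false => VKind.wire

def VKind.toBool : VKind → Bool
  | VKind.node => true
  | VKind.wire => false

/-- `true` stands for `in` and `false` for `out`. -/
def EdgeDir.toBool : EdgeDir → Bool
  | EdgeDir.incoming => true
  | EdgeDir.outgoing => false

/-- A finite description of a !-graph: the kinds of its vertices `0, 1, …`, its edges, the number
of its !-boxes, the pairs `(a, b)` of !-boxes with `a ≤ b`, and the pairs `(a, v)` with the vertex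
`v` in the contents of the !-box `a`. -/
structure BangCode where
  kinds : List Bool
  edges : List (ℕ × ℕ)
  boxCount : ℕ
  order : List (ℕ × ℕ)
  inside : List (ℕ × ℕ)

def BangCode.equiv : BangCode ≃
    List Bool × List (ℕ × ℕ) × ℕ × List (ℕ × ℕ) × List (ℕ × ℕ) where
  toFun c := (c.kinds, c.edges, c.boxCount, c.order, c.inside)
  invFun t := ⟨t.1, t.2.1, t.2.2.1, t.2.2.2.1, t.2.2.2.2⟩
  left_inv _ := rfl
  right_inv _ := rfl

instance : Primcodable BangCode := Primcodable.ofEquiv _ BangCode.equiv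

/-- `c` describes the !-graph `H`, for some numbering of the vertices and !-boxes of `H`. -/
def BangCode.Encodes (c : BangCode) (H : BangGraph) : Prop :=
  ∃ (e : Fin c.kinds.length ≃ H.graph.V) (d : Fin c.boxCount ≃ H.Box),
    (∀ i, H.graph.lab (e i) = VKind.ofBool (c.kinds.get i)) ∧
    (∀ i j, H.graph.E (e i) () (e j) ↔ (i.val, j.val) ∈ c.edges) ∧
    (∀ a b, d a ≤ d b ↔ (a.val, b.val) ∈ c.order) ∧
    (∀ a i, e i ∈ H.content (d a) ↔ (a.val, i.val) ∈ c.inside)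

/-- A finite description of a production: its left-hand side, the labels of the nodes `0, 1, …` of
its right-hand side, and the edges and connection instructions `(σ, β, γ, x, d)` of the right-hand
side. A node label is a vertex kind or the number of a nonterminal; an edge label is `none` for the
final label or the number of a non-final label. -/
structure ProdCode where
  lhs : ℕ
  labels : List (Bool ⊕ ℕ)
  edges : List (ℕ × Option ℕ × ℕ)
  conns : List ((Bool ⊕ ℕ) × Option ℕ × Option ℕ × ℕ × Bool)

def ProdCode.equiv : ProdCode ≃ ℕ × List (Bool ⊕ ℕ) × List (ℕ × Option ℕ × ℕ) ×
    List ((Bool ⊕ ℕ) × Option ℕ × Option ℕ × ℕ × Bool) where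
  toFun c := (c.lhs, c.labels, c.edges, c.conns)
  invFun t := ⟨t.1, t.2.1, t.2.2.1, t.2.2.2⟩
  left_inv _ := rfl
  right_inv _ := rfl

instance : Primcodable ProdCode := Primcodable.ofEquiv _ ProdCode.equiv

/-- A finite description of an edNCE grammar over the labels of string graphs. The nonterminals are
`0, …, ntMax`, the non-final edge labels are `0, …, nfCount - 1`. -/
structure GrammarCode where
  ntMax : ℕ
  nfCount : ℕ
  start : ℕ
  prods : List ProdCode

def GrammarCode.equiv : GrammarCode ≃ ℕ × ℕ × ℕ × List ProdCode where
  toFun c := (c.ntMax, c.nfCount, c.start, c.prods)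
  invFun t := ⟨t.1, t.2.1, t.2.2.1, t.2.2.2⟩
  left_inv _ := rfl
  right_inv _ := rfl

instance : Primcodable GrammarCode := Primcodable.ofEquiv _ GrammarCode.equiv

/-- The number describing an edge label. -/
def edgeLabelCode {l : ℕ} : Unit ⊕ Fin l → Option ℕ
  | Sum.inl _ => none
  | Sum.inr a => some a.val

/-- The description of a node label. -/
def nodeLabelCode {k : ℕ} : VKind ⊕ Fin k → Bool ⊕ ℕ
  | Sum.inl s => Sum.inl s.toBool
  | Sum.inr X => Sum.inr X.val

/-- The node label with a given description. So that every description denotes a label, a number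
greater than `k` is reduced modulo `k + 1`. -/
def nodeLabelOf (k : ℕ) : Bool ⊕ ℕ → VKind ⊕ Fin (k + 1)
  | Sum.inl s => Sum.inl (VKind.ofBool s)
  | Sum.inr X => Sum.inr (Fin.ofNat (k + 1) X)

/-- The right-hand side of a described production, with nonterminals `0, …, k` and non-final edge
labels `0, …, l - 1`. -/
def ProdCode.graph (c : ProdCode) (k l : ℕ) :
    EGraph (VKind ⊕ Fin (k + 1)) (Unit ⊕ Fin l) where
  V := Fin c.labels.length
  finite_V := inferInstance
  E i γ j := i ≠ j ∧ (i.val, edgeLabelCode γ, j.val) ∈ c.edges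
  irrefl _ _ h := h.1 rfl
  lab i := nodeLabelOf k (c.labels.get i)
  C σ β γ i d :=
    (nodeLabelCode σ, edgeLabelCode β, edgeLabelCode γ, i.val, d.toBool) ∈ c.conns

/-- The grammar with a given description. -/
def GrammarCode.grammar (c : GrammarCode) : EdNCE VKind Unit where
  NT := Fin (c.ntMax + 1)
  finite_NT := inferInstance
  NF := Fin c.nfCount
  finite_NF := inferInstance
  start := Fin.ofNat (c.ntMax + 1) c.start
  Prd := Fin c.prods.length
  finite_Prd := inferInstance
  lhs p := Fin.ofNat (c.ntMax + 1) (c.prods.get p).lhs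
  rhs p := (c.prods.get p).graph c.ntMax c.nfCount

/-- Every !-graph has a finite description. -/
theorem BangGraph.exists_encodes (H : BangGraph) : ∃ c : BangCode, c.Encodes H := by
  classical
  have := H.graph.finite_V
  have := H.finite_Box
  obtain ⟨n, ⟨e⟩⟩ := Finite.exists_equiv_fin H.graph.V
  obtain ⟨m, ⟨d⟩⟩ := Finite.exists_equiv_fin H.Box
  let E : Finset (Fin n × Fin n) := {x | H.graph.E (e.symm x.1) () (e.symm x.2)}
  let O : Finset (Fin m × Fin m) := {x | d.symm x.1 ≤ d.symm x.2}
  let I : Finset (Fin m × Fin n) := {x | e.symm x.2 ∈ H.content (d.symm x.1)}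
  have hl : (List.ofFn fun i => (H.graph.lab (e.symm i)).toBool).length = n := List.length_ofFn
  have hk : ∀ s : VKind, s = VKind.ofBool s.toBool := by rintro (_ | _) <;> rfl
  refine ⟨⟨List.ofFn fun i => (H.graph.lab (e.symm i)).toBool,
    E.toList.map fun x => (x.1.val, x.2.val), m, O.toList.map fun x => (x.1.val, x.2.val),
    I.toList.map fun x => (x.1.val, x.2.val)⟩, (finCongr hl).trans e.symm, d.symm, ?_, ?_, ?_, ?_⟩
  · intro i
    simp only [List.get_eq_getElem, List.getElem_ofFn]
    exact hk _
  · intro i j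
    have hi : i.val < n := by simpa using i.2
    have hj : j.val < n := by simpa using j.2
    have h1 : ((finCongr hl).trans e.symm) i = e.symm ⟨i.val, hi⟩ := rfl
    have h2 : ((finCongr hl).trans e.symm) j = e.symm ⟨j.val, hj⟩ := rfl
    rw [h1, h2]
    simp only [List.mem_map, Finset.mem_toList, E, Finset.mem_filter, Finset.mem_univ, true_and,
      Prod.mk.injEq, Prod.exists]
    constructor
    · intro h
      exact ⟨_, _, h, rfl, rfl⟩
    · rintro ⟨a, b, h, ha, hb⟩
      have : a = ⟨i.val, hi⟩ := Fin.ext ha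
      have : b = ⟨j.val, hj⟩ := Fin.ext hb
      subst_vars
      exact h
  · intro a b
    simp only [List.mem_map, Finset.mem_toList, O, Finset.mem_filter, Finset.mem_univ, true_and,
      Prod.mk.injEq, Prod.exists]
    constructor
    · intro h
      exact ⟨_, _, h, rfl, rfl⟩
    · rintro ⟨a', b', h, ha, hb⟩
      have := Fin.ext ha
      have := Fin.ext hb
      subst_vars
      exact h
  · intro a i
    have hi : i.val < n := by simpa using i.2
    have h1 : ((finCongr hl).trans e.symm) i = e.symm ⟨i.val, hi⟩ := rfl
    rw [h1]
    simp only [List.mem_map, Finset.mem_toList, I, Finset.mem_filter, Finset.mem_univ, true_and,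
      Prod.mk.injEq, Prod.exists]
    constructor
    · intro h
      exact ⟨_, _, h, rfl, rfl⟩
    · rintro ⟨a', b', h, ha, hb⟩
      have := Fin.ext ha
      have : b' = ⟨i.val, hi⟩ := Fin.ext hb
      subst_vars
      exact h

/-! ### A declarative description of the language of a !-graph -/

namespace BangGraph

/-! The sequence of operations can be forgotten in favour of its result. A graph in the language is
an `Instantiation`: each vertex is a copy of a vertex of `H` and has a copy number for every !-box
containing that vertex; two copies are adjacent when the originals are and their numbers agree on
the common !-boxes; and every combination of existing copies is realised exactly once. By
`mem_language_iff` these instances are precisely the language. `KILL` leaves a !-box without copies,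
`EXPAND` splits off one copy, and conversely the copies of a maximal !-box can be split off one at a
time.

A grammar with a single nonterminal node can generate an instance by walking depth first through the
nested copies of !-boxes. Without overlaps the !-boxes containing a given vertex form a chain, so
the walk can reach every vertex. The nonterminal remembers only the innermost open !-box. Entering a
copy creates at once the vertices that lie in exactly the open !-boxes; afterwards a copy of a child
may be entered or the current copy closed.

The difficulty lies in the edges between new and old vertices: they depend on copy numbers, but a
production sees only the labels of edges at the nonterminal node. Openness resolves this. A
wire-vertex lies in every !-box of each of its neighbours. So an old neighbour of a new vertex is
not a wire-vertex, since it would lie in the copy just opened. It is a node-vertex, the new vertex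
is a wire-vertex, and openness now shows that all copies of !-boxes around the old vertex are still
open. Hence it suffices that a node-vertex keeps its own label while it is live and receives an
inert label when a copy around it is closed. Labels of wire-vertices never create edges, so one of
them serves as the inert label, and one label per vertex of `H` is enough. If `H` has no
wire-vertices, it has no edges.

`Rep` expresses this invariant, and `Rep.gen`, `Rep.call` and `Rep.close` preserve it. Soundness is
`sound_of_derives`, which keeps a saturated record of the existing copies along a derivation.
Completeness is `Tour.exists_complete`, which lets a derivation follow a given instance until every
vertex is visited. Finally `toGrammar` writes such a grammar down from a description and is
primitive recursive. -/

theorem Reaches.trans {G G' G'' : BangGraph} (h : Reaches G G') (h' : Reaches G' G'') :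
    Reaches G G'' := by
  induction h' with
  | refl => exact h
  | kill K b _ ih => exact Reaches.kill K b ih
  | expand K b _ ih => exact Reaches.expand K b ih

theorem language_kill_subset (G : BangGraph) (b : G.Box) : (G.kill b).language ⊆ G.language := by
  rintro K ⟨G', h, hc, hi⟩
  exact ⟨G', (Reaches.kill G b Reaches.refl).trans h, hc, hi⟩

theorem language_expand_subset (G : BangGraph) (b : G.Box) :
    (G.expand b).language ⊆ G.language := by
  rintro K ⟨G', h, hc, hi⟩
  exact ⟨G', (Reaches.expand G b Reaches.refl).trans h, hc, hi⟩

/-- `K` is an instance of the !-graph `G`: a vertex `x` of `K` is a copy of the vertex `π x` of `G`,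
and it lies in copy number `ix x b` of each !-box `b` that contains `π x`. The predicate `σ b f`
says that copy number `f b` of `b` exists, inside copy number `f c` of each `c > b`. -/
structure Instantiation (G : BangGraph) (K : KGraph) where
  π : K.V → G.graph.V
  ix : K.V → G.Box → ℕ
  σ : G.Box → (G.Box → ℕ) → Prop
  lab : ∀ x, K.lab x = G.graph.lab (π x)
  edge : ∀ x y, K.E x () y ↔ G.graph.E (π x) () (π y) ∧
    ∀ b, π x ∈ G.content b → π y ∈ G.content b → ix x b = ix y b
  inj : ∀ x y, π x = π y → (∀ b, π x ∈ G.content b → ix x b = ix y b) → x = y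
  congr : ∀ b f g, (∀ c, b ≤ c → f c = g c) → σ b f → σ b g
  mem : ∀ x b, π x ∈ G.content b → σ b (ix x)
  sat : ∀ v f, (∀ b, v ∈ G.content b → σ b f) →
    ∃ x, π x = v ∧ ∀ b, v ∈ G.content b → ix x b = f b

def IsInstance (G : BangGraph) (K : KGraph) : Prop := Nonempty (Instantiation G K)

theorem isInstance_of_isoTo {G : BangGraph} (hG : G.IsConcrete) {K : KGraph}
    (h : G.graph.IsoTo K) : G.IsInstance K := by
  obtain ⟨e, hl, hE⟩ := h
  have : IsEmpty G.Box := hG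
  refine ⟨⟨e.symm, fun _ _ => 0, fun _ _ => True, ?_, ?_, ?_, ?_, ?_, ?_⟩⟩
  · intro x; simpa using hl (e.symm x)
  · intro x y
    have := hE (e.symm x) () (e.symm y)
    simp only [Equiv.apply_symm_apply] at this
    rw [this]
    exact ⟨fun h => ⟨h, fun _ _ _ => rfl⟩, fun h => h.1⟩
  · intro x y h _; exact e.symm.injective h
  · intro b; exact isEmptyElim b
  · intro x b; exact isEmptyElim b
  · intro v f _; exact ⟨e v, by simp, fun b => isEmptyElim b⟩

theorem Instantiation.isoTo {G : BangGraph} (hG : G.IsConcrete) {K : KGraph}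
    (I : Instantiation G K) : G.graph.IsoTo K := by
  have : IsEmpty G.Box := hG
  have hbij : Function.Bijective I.π :=
    ⟨fun x y h => I.inj x y h fun b => isEmptyElim b,
      fun v => (I.sat v (fun _ => 0) fun b => isEmptyElim b).imp fun _ h => h.1⟩
  let e := Equiv.ofBijective I.π hbij
  have he : ∀ v, I.π (e.symm v) = v := e.apply_symm_apply
  refine ⟨e.symm, fun v => by rw [I.lab, he], fun v γ w => ?_⟩
  rw [I.edge, he, he]
  exact ⟨fun h => h.1, fun h => ⟨h, fun b => isEmptyElim b⟩⟩

/-- Killing `b` amounts to having no copies of `b` or of anything nested in it, so `σ` is made false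
there. The number `0` assigned to the removed !-boxes is never consulted, because by monotonicity no
surviving vertex lies in them. -/
theorem IsInstance.of_kill {G : BangGraph} {b : G.Box} {K : KGraph}
    (h : (G.kill b).IsInstance K) : G.IsInstance K := by
  classical
  obtain ⟨I⟩ := h
  have hb : ∀ (x : (G.kill b).graph.V) c, x.1 ∈ G.content c → ¬ c ≤ b :=
    fun x c hc hcb => x.2 (G.mono c b hcb hc)
  refine ⟨⟨fun x => (I.π x).1, fun x c => if h : ¬ c ≤ b then I.ix x ⟨c, h⟩ else 0,
    fun c f => ∃ h : ¬ c ≤ b, I.σ ⟨c, h⟩ fun e => f e.1, fun x => I.lab x, ?_, ?_, ?_, ?_, ?_⟩⟩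
  · intro x y
    rw [I.edge]
    refine and_congr Iff.rfl ⟨fun h c hx hy => ?_, fun h c hx hy => ?_⟩
    · rw [dif_pos (hb _ c hx), dif_pos (hb _ c hx)]
      exact h ⟨c, hb _ c hx⟩ hx hy
    · have := h c.1 hx hy
      rwa [dif_pos c.2, dif_pos c.2] at this
  · intro x y hxy h
    refine I.inj x y (Subtype.ext hxy) fun c hc => ?_
    have := h c.1 hc
    rwa [dif_pos c.2, dif_pos c.2] at this
  · rintro c f g hfg ⟨h, hf⟩
    exact ⟨h, I.congr _ _ _ (fun e he => hfg e.1 he) hf⟩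
  · intro x c hc
    refine ⟨hb _ c hc, ?_⟩
    refine I.congr _ _ _ (fun e _ => ?_) (I.mem x ⟨c, hb _ c hc⟩ hc)
    simp only [dif_pos e.2]
    rfl
  · intro v f h
    have hv : v ∉ G.content b := fun hv => (h b hv).1 le_rfl
    obtain ⟨x, hx, hf⟩ := I.sat ⟨v, hv⟩ (fun e => f e.1) fun c hc => (h c.1 hc).2
    refine ⟨x, congrArg Subtype.val hx, fun c hc => ?_⟩
    rw [dif_pos (hb ⟨v, hv⟩ c hc)]
    exact hf ⟨c, hb ⟨v, hv⟩ c hc⟩ hc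

/-- The vertex of `G` of which a vertex of `EXPAND_b(G)` is a copy. -/
def expandVertex (G : BangGraph) (b : G.Box) : (G.expand b).graph.V → G.graph.V
  | Sum.inl v => v
  | Sum.inr v => v.1

open Classical in
/-- Copy number `0` of `b` is the one made by `EXPAND_b`; the other copies are shifted. -/
noncomputable def expandIndex (G : BangGraph) (b : G.Box) (f : (G.expand b).Box → ℕ) :
    (G.expand b).graph.V → G.Box → ℕ
  | Sum.inl _, c => if c = b then f (Sum.inl b) + 1 else f (Sum.inl c)
  | Sum.inr _, c => if h : c < b then f (Sum.inr ⟨c, h⟩) else if c = b then 0 else f (Sum.inl c)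

open Classical in
/-- The numbering of copies for `EXPAND_b(G)` induced by one for `G`. -/
noncomputable def unexpandIndex (G : BangGraph) (b : G.Box) (f : G.Box → ℕ) : (G.expand b).Box → ℕ
  | Sum.inl d => if d = b then f b - 1 else f d
  | Sum.inr d => f d.1

/-- Within one copy the numbers are merely shifted or renamed. Between the two copies, the number of
`b` is `0` on one side and a successor on the other, so agreement on common !-boxes fails exactly
when both ends lie in `b`; this is the condition built into `double`. -/
theorem expand_edge_iff (G : BangGraph) (b : G.Box) (z w : (G.expand b).graph.V)
    (f g : (G.expand b).Box → ℕ) :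
    ((G.expand b).graph.E z () w ∧ ∀ c, z ∈ (G.expand b).content c →
      w ∈ (G.expand b).content c → f c = g c) ↔
    (G.graph.E (G.expandVertex b z) () (G.expandVertex b w) ∧
      ∀ c, G.expandVertex b z ∈ G.content c → G.expandVertex b w ∈ G.content c →
        G.expandIndex b f z c = G.expandIndex b g w c) := by
  classical
  rcases z with u | u <;> rcases w with v | v
  · refine and_congr Iff.rfl ⟨fun h c hu hv => ?_, fun h c hu hv => ?_⟩
    · simp only [expandIndex]
      split_ifs with hc
      · rw [h (Sum.inl b) (hc ▸ hu : u ∈ G.content b) (hc ▸ hv : v ∈ G.content b)]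
      · exact h (Sum.inl c) hu hv
    · rcases c with c | c
      · have := h c hu hv
        simp only [expandIndex] at this
        split_ifs at this with hc
        · subst hc; omega
        · exact this
      · exact hu.elim
  · constructor
    · rintro ⟨⟨hu, he⟩, h⟩
      refine ⟨he, fun c hcu hcv => ?_⟩
      have hcb : ¬ c ≤ b := fun hcb => hu (G.mono c b hcb hcu)
      simp only [expandIndex]
      rw [if_neg (fun h => hcb h.le), dif_neg (fun h => hcb h.le), if_neg (fun h => hcb h.le)]
      exact h (Sum.inl c) hcu ⟨hcb, hcv⟩
    · rintro ⟨he, h⟩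
      have hu : u ∉ G.content b := by
        intro hu
        have := h b hu v.2
        simp [expandIndex] at this
      refine ⟨⟨hu, he⟩, fun c hcu hcv => ?_⟩
      rcases c with c | c
      · have := h c hcu hcv.2
        simp only [expandIndex] at this
        have hcb := hcv.1
        rwa [if_neg (fun h => hcb h.le), dif_neg (fun h => hcb h.le),
          if_neg (fun h => hcb h.le)] at this
      · exact hcu.elim
  · constructor
    · rintro ⟨⟨hu, he⟩, h⟩
      refine ⟨he, fun c hcu hcv => ?_⟩
      have hcb : ¬ c ≤ b := fun hcb => hu (G.mono c b hcb hcv)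
      simp only [expandIndex]
      rw [if_neg (fun h => hcb h.le), dif_neg (fun h => hcb h.le), if_neg (fun h => hcb h.le)]
      exact h (Sum.inl c) ⟨hcb, hcu⟩ hcv
    · rintro ⟨he, h⟩
      have hv : v ∉ G.content b := by
        intro hv
        have := h b u.2 hv
        simp [expandIndex] at this
      refine ⟨⟨hv, he⟩, fun c hcu hcv => ?_⟩
      rcases c with c | c
      · have := h c hcu.2 hcv
        simp only [expandIndex] at this
        have hcb := hcu.1
        rwa [if_neg (fun h => hcb h.le), dif_neg (fun h => hcb h.le),
          if_neg (fun h => hcb h.le)] at this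
      · exact hcv.elim
  · refine and_congr Iff.rfl ⟨fun h c hu hv => ?_, fun h c hu hv => ?_⟩
    · simp only [expandIndex]
      split_ifs with hc hc'
      · exact h (Sum.inr ⟨c, hc⟩) hu hv
      · rfl
      · have hcb : ¬ c ≤ b := fun h => h.lt_or_eq.elim hc hc'
        exact h (Sum.inl c) ⟨hcb, hu⟩ ⟨hcb, hv⟩
    · rcases c with c | c
      · have := h c hu.2 hv.2
        simp only [expandIndex] at this
        have hcb := hu.1
        rwa [dif_neg (fun h => hcb h.le), dif_neg (fun h => hcb h.le),
          if_neg (fun h => hcb h.le), if_neg (fun h => hcb h.le)] at this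
      · have := h c.1 hu hv
        simp only [expandIndex] at this
        rwa [dif_pos c.2, dif_pos c.2] at this

/-- The number of `b`, zero or a successor, tells the fresh contents from the old ones, and within
either of them the renumbering is injective. -/
theorem expand_ext (G : BangGraph) (b : G.Box) (z w : (G.expand b).graph.V)
    (f g : (G.expand b).Box → ℕ) (h : G.expandVertex b z = G.expandVertex b w)
    (hi : ∀ c, G.expandVertex b z ∈ G.content c → G.expandIndex b f z c = G.expandIndex b g w c) :
    z = w ∧ ∀ c, z ∈ (G.expand b).content c → f c = g c := by
  classical
  rcases z with u | u <;> rcases w with v | v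
  · obtain rfl : u = v := h
    refine ⟨rfl, fun c hc => ?_⟩
    rcases c with c | c
    · have := hi c hc
      simp only [expandIndex] at this
      split_ifs at this with hc
      · subst hc; omega
      · exact this
    · exact hc.elim
  · have := hi b (by rw [h]; exact v.2)
    simp [expandIndex] at this
  · have := hi b u.2
    simp [expandIndex] at this
  · obtain rfl : u = v := Subtype.ext h
    refine ⟨rfl, fun c hc => ?_⟩
    rcases c with c | c
    · have := hi c hc.2
      simp only [expandIndex] at this
      have hcb := hc.1
      rwa [dif_neg (fun h => hcb h.le), dif_neg (fun h => hcb h.le),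
        if_neg (fun h => hcb h.le), if_neg (fun h => hcb h.le)] at this
    · have := hi c.1 hc
      simp only [expandIndex] at this
      rwa [dif_pos c.2, dif_pos c.2] at this

theorem IsInstance.of_expand {G : BangGraph} {b : G.Box} {K : KGraph}
    (h : (G.expand b).IsInstance K) : G.IsInstance K := by
  classical
  obtain ⟨I⟩ := h
  refine ⟨⟨fun x => G.expandVertex b (I.π x), fun x => G.expandIndex b (I.ix x) (I.π x),
    -- Copy number `0` of `b` always exists: for `c = b` the quantifier over `c < b` is vacuous.
    -- Inside that copy the fresh !-boxes decide which copies exist, everywhere else the old ones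
    -- do.
    fun c f => if c ≤ b ∧ f b = 0 then ∀ h : c < b, I.σ (Sum.inr ⟨c, h⟩) (G.unexpandIndex b f)
      else I.σ (Sum.inl c) (G.unexpandIndex b f), ?_, ?_, ?_, ?_, ?_, ?_⟩⟩
  · intro x
    rw [I.lab]
    cases I.π x <;> rfl
  · intro x y
    rw [I.edge]
    exact expand_edge_iff G b _ _ _ _
  · intro x y hxy h
    obtain ⟨h1, h2⟩ := expand_ext G b _ _ _ _ hxy h
    exact I.inj x y h1 h2
  · intro c f g hfg hf
    have hF : ∀ e, (G.expand b).order.le (Sum.inl c) e →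
        G.unexpandIndex b f e = G.unexpandIndex b g e := by
      rintro (e | e) he
      · simp only [unexpandIndex]
        split_ifs with heb
        · subst heb; rw [hfg _ he]
        · exact hfg _ he
      · exact he.elim
    by_cases hc : c ≤ b ∧ f b = 0
    · rw [if_pos hc] at hf
      rw [if_pos ⟨hc.1, hfg b hc.1 ▸ hc.2⟩]
      refine fun h => I.congr _ _ _ ?_ (hf h)
      rintro (e | e) he
      · have heb : e ≠ b := fun h => he.2 h.le
        simp only [unexpandIndex, if_neg heb]
        exact hfg _ he.1
      · exact hfg _ he
    · rw [if_neg hc] at hf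
      rw [if_neg fun h => hc ⟨h.1, by rw [hfg b h.1, h.2]⟩]
      exact I.congr _ _ _ hF hf
  · intro x c hc
    have hm := I.mem x
    generalize I.π x = z at *
    generalize I.ix x = f at *
    rcases z with u | u
    · have h0 : ¬ (c ≤ b ∧ G.expandIndex b f (Sum.inl u) b = 0) := by simp [expandIndex]
      rw [if_neg h0]
      refine I.congr _ _ _ ?_ (hm (Sum.inl c) hc)
      rintro (e | e) he
      · by_cases heb : e = b
        · subst heb; simp [unexpandIndex, expandIndex]
        · simp [unexpandIndex, expandIndex, heb]
      · exact he.elim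
    · by_cases hcb : c ≤ b
      · have h0 : c ≤ b ∧ G.expandIndex b f (Sum.inr u) b = 0 := by simp [expandIndex, hcb]
        rw [if_pos h0]
        intro h
        refine I.congr _ _ _ ?_ (hm (Sum.inr ⟨c, h⟩) hc)
        rintro (e | e) he
        · have h1 : e ≠ b := fun h => he.2 h.le
          have h2 : ¬ e < b := fun h => he.2 h.le
          simp [unexpandIndex, expandIndex, h1, h2]
        · have := e.2
          simp [unexpandIndex, expandIndex, this]
      · rw [if_neg (fun h => hcb h.1)]
        refine I.congr _ _ _ ?_ (hm (Sum.inl c) ⟨hcb, hc⟩)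
        rintro (e | e) he
        · have he' : ¬ e ≤ b := fun h => hcb (le_trans (α := G.Box) he h)
          have h1 : e ≠ b := fun h => he' h.le
          have h2 : ¬ e < b := fun h => he' h.le
          simp [unexpandIndex, expandIndex, h1, h2]
        · exact he.elim
  · intro v f h
    -- A vertex of `b` with number `0` is sought in the fresh contents, every other one in the old
    -- graph.
    by_cases h0 : v ∈ G.content b ∧ f b = 0
    · obtain ⟨x, hx, hi⟩ := I.sat (Sum.inr ⟨v, h0.1⟩) (G.unexpandIndex b f) (by
        rintro (c | c) hc
        · have := h c hc.2
          rwa [if_neg fun h => hc.1 h.1] at this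
        · have := h c.1 hc
          rw [if_pos ⟨c.2.le, h0.2⟩] at this
          exact this c.2)
      refine ⟨x, by simp only [hx]; rfl, fun c hc => ?_⟩
      simp only [hx, expandIndex]
      split_ifs with h1 h2
      · exact hi (Sum.inr ⟨c, h1⟩) hc
      · rw [h2, h0.2]
      · rw [hi (Sum.inl c) ⟨fun h => h.lt_or_eq.elim h1 h2, hc⟩]
        simp [unexpandIndex, h2]
    · obtain ⟨x, hx, hi⟩ := I.sat (Sum.inl v) (G.unexpandIndex b f) (by
        rintro (c | c) hc
        · have := h c hc
          rwa [if_neg fun h => h0 ⟨G.mono c b h.1 hc, h.2⟩] at this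
        · exact hc.elim)
      refine ⟨x, by simp only [hx]; rfl, fun c hc => ?_⟩
      simp only [hx, expandIndex]
      split_ifs with h1
      · subst h1
        rw [hi (Sum.inl c) hc]
        -- Needed because `unexpandIndex` subtracts `1` in the natural numbers.
        have : f c ≠ 0 := fun h => h0 ⟨hc, h⟩
        simp only [unexpandIndex, if_true]
        omega
      · rw [hi (Sum.inl c) hc]
        simp [unexpandIndex, h1]

theorem isInstance_of_mem_language {G : BangGraph} {K : KGraph} (h : K ∈ G.language) :
    G.IsInstance K := by
  obtain ⟨G', hr, hc, hi⟩ := h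
  have hK : G'.IsInstance K := isInstance_of_isoTo hc hi
  clear hc hi
  induction hr with
  | refl => exact hK
  | kill K' b _ ih => exact ih hK.of_kill
  | expand K' b _ ih => exact ih hK.of_expand

end BangGraph

/-! ### Every instance is obtained by !-box operations -/

namespace BangGraph

/-- Every copy of a !-box occurs in the list `l`. -/
def Instantiation.CoveredBy {G : BangGraph} {K : KGraph} (I : Instantiation G K)
    (l : List (G.Box × (G.Box → ℕ))) : Prop :=
  ∀ b f, I.σ b f → ∃ p ∈ l, p.1 = b ∧ ∀ c, b ≤ c → p.2 c = f c

/-- An instance has a description with finitely many copies of !-boxes. -/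
theorem IsInstance.exists_coveredBy {G : BangGraph} {K : KGraph} (h : G.IsInstance K) :
    ∃ (I : Instantiation G K) (l : List (G.Box × (G.Box → ℕ))), I.CoveredBy l := by
  classical
  obtain ⟨I⟩ := h
  have := K.finite_V
  have := G.finite_Box
  have := Fintype.ofFinite (K.V × G.Box)
  -- Copies without vertices are dropped from `σ`. This only weakens the demands of saturation, and
  -- the finitely many pairs of a vertex and a !-box list all copies that remain.
  refine ⟨⟨I.π, I.ix, fun b f => ∃ x, I.π x ∈ G.content b ∧ ∀ c, b ≤ c → I.ix x c = f c,
    I.lab, I.edge, I.inj, ?_, fun x b hb => ⟨x, hb, fun _ _ => rfl⟩, ?_⟩,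
    (Finset.univ : Finset (K.V × G.Box)).toList.map fun p => (p.2, I.ix p.1), ?_⟩
  · rintro b f g hfg ⟨x, hx, hf⟩
    exact ⟨x, hx, fun c hc => (hf c hc).trans (hfg c hc)⟩
  · intro v f h
    refine I.sat v f fun b hb => ?_
    obtain ⟨x, hx, hf⟩ := h b hb
    exact I.congr _ _ _ hf (I.mem x b hx)
  · rintro b f ⟨x, hx, hf⟩
    exact ⟨(b, I.ix x), by simp, rfl, hf⟩

/-- An instance of `G` without copies of `b` is an instance of `KILL_b(G)`. -/
theorem Instantiation.exists_kill {G : BangGraph} {K : KGraph} (I : Instantiation G K)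
    {l : List (G.Box × (G.Box → ℕ))} (hl : I.CoveredBy l) (b : G.Box) (hb : ∀ f, ¬ I.σ b f) :
    ∃ (J : Instantiation (G.kill b) K) (l' : List ((G.kill b).Box × ((G.kill b).Box → ℕ))),
      J.CoveredBy l' ∧ l'.length ≤ l.length := by
  classical
  have hx : ∀ x, I.π x ∉ G.content b := fun x hx => hb _ (I.mem x b hx)
  have hc : ∀ v : (G.kill b).graph.V, ∀ c, v.1 ∈ G.content c → ¬ c ≤ b :=
    fun v c hc hcb => v.2 (G.mono c b hcb hc)
  -- The default `0` is harmless: a !-box above a surviving one survives too, and `σ` depends only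
  -- on numbers at such !-boxes.
  let ext : ((G.kill b).Box → ℕ) → G.Box → ℕ := fun f c => if h : ¬ c ≤ b then f ⟨c, h⟩ else 0
  have hext : ∀ f (c : (G.kill b).Box), ext f c.1 = f c := fun f c => dif_pos c.2
  refine ⟨⟨fun x => ⟨I.π x, hx x⟩, fun x c => I.ix x c.1, fun c f => I.σ c.1 (ext f), I.lab, ?_, ?_,
    ?_, ?_, ?_⟩, l.filterMap (fun p => if h : ¬ p.1 ≤ b then some (⟨p.1, h⟩, fun c => p.2 c.1)
      else none), ?_, List.length_filterMap_le _ _⟩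
  · intro x y
    rw [I.edge]
    exact and_congr Iff.rfl ⟨fun h c hx hy => h c.1 hx hy,
      fun h c h1 h2 => h ⟨c, hc ⟨_, hx x⟩ c h1⟩ h1 h2⟩
  · intro x y hxy h
    exact I.inj x y (congrArg Subtype.val hxy) fun c h1 => h ⟨c, hc ⟨_, hx x⟩ c h1⟩ h1
  · intro c f g hfg
    refine I.congr _ _ _ fun e he => ?_
    have heb : ¬ e ≤ b := fun h => c.2 (he.trans h)
    rw [hext f ⟨e, heb⟩, hext g ⟨e, heb⟩]
    exact hfg _ he
  · intro x c hxc
    refine I.congr _ _ _ (fun e he => ?_) (I.mem x c.1 hxc)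
    have heb : ¬ e ≤ b := fun h => c.2 (he.trans h)
    exact (hext (fun c => I.ix x c.1) ⟨e, heb⟩).symm
  · intro v f h
    obtain ⟨x, h1, h2⟩ := I.sat v.1 (ext f) fun c h1 => h ⟨c, hc v c h1⟩ h1
    refine ⟨x, Subtype.ext h1, fun c h3 => ?_⟩
    rw [h2 c.1 h3, hext]
  · intro c f hf
    obtain ⟨p, hp, h1, h2⟩ := hl c.1 _ hf
    have hpb : ¬ p.1 ≤ b := h1 ▸ c.2
    refine ⟨(⟨p.1, hpb⟩, fun c => p.2 c.1), List.mem_filterMap.2 ⟨p, hp, dif_pos hpb⟩,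
      Subtype.ext h1, fun e he => ?_⟩
    rw [← hext f e]
    exact h2 e.1 he

/-- Copy number `a` of a maximal !-box `b` can be obtained as the new copy in `EXPAND_b(G)`. -/
theorem Instantiation.exists_expand {G : BangGraph} {K : KGraph} (I : Instantiation G K)
    {l : List (G.Box × (G.Box → ℕ))} (hl : I.CoveredBy l) (b : G.Box) (hmax : ∀ c, b ≤ c → c = b)
    (f₀ : G.Box → ℕ) (hf₀ : I.σ b f₀) :
    ∃ (J : Instantiation (G.expand b) K) (l' : List ((G.expand b).Box × ((G.expand b).Box → ℕ))),
      J.CoveredBy l' ∧ l'.length < l.length := by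
  classical
  let a := f₀ b
  -- The numbering of `G` as seen from inside the split-off copy: numbers of the fresh !-boxes below
  -- `b`, the fixed number `a` at `b`, and unchanged numbers elsewhere.
  let glue : ((G.expand b).Box → ℕ) → G.Box → ℕ := fun g e =>
    if h : e < b then g (Sum.inr ⟨e, h⟩) else if e = b then a else g (Sum.inl e)
  let π : K.V → (G.expand b).graph.V := fun x =>
    if h : I.π x ∈ G.content b ∧ I.ix x b = a then Sum.inr ⟨I.π x, h.1⟩ else Sum.inl (I.π x)
  let cp : (G.Box → ℕ) → (G.expand b).Box → ℕ := fun f c => match c with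
    | Sum.inl c => f c
    | Sum.inr c => f c.1
  let σ : (G.expand b).Box → ((G.expand b).Box → ℕ) → Prop := fun c g => match c with
    | Sum.inl c => I.σ c (fun e => g (Sum.inl e)) ∧ ¬ (c ≤ b ∧ g (Sum.inl b) = a)
    | Sum.inr c => I.σ c.1 (glue g)
  -- Listed copies nested in copy `a` of `b` move to the fresh !-boxes, and copy `a` itself is
  -- deleted, which shortens the list. Copies of !-boxes not nested in `b` stay, even if their
  -- irrelevant entry at `b` happens to be `a`.
  let F : G.Box × (G.Box → ℕ) → Option ((G.expand b).Box × ((G.expand b).Box → ℕ)) := fun p =>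
    if p.2 b = a then
      if h : p.1 < b then some (Sum.inr ⟨p.1, h⟩, cp p.2)
      else if p.1 = b then none else some (Sum.inl p.1, cp p.2)
    else some (Sum.inl p.1, cp p.2)
  have hπ : ∀ x, (∃ h : I.π x ∈ G.content b ∧ I.ix x b = a, π x = Sum.inr ⟨I.π x, h.1⟩) ∨
      (¬ (I.π x ∈ G.content b ∧ I.ix x b = a) ∧ π x = Sum.inl (I.π x)) := by
    intro x
    by_cases h : I.π x ∈ G.content b ∧ I.ix x b = a
    · exact Or.inl ⟨h, dif_pos h⟩
    · exact Or.inr ⟨h, dif_neg h⟩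
  refine ⟨⟨π, fun x => cp (I.ix x), σ, ?_, ?_, ?_, ?_, ?_, ?_⟩, l.filterMap F, ?_, ?_⟩
  · intro x
    rw [I.lab]
    rcases hπ x with ⟨h, hx⟩ | ⟨h, hx⟩ <;> rw [hx] <;> rfl
  · intro x y
    rw [I.edge]
    rcases hπ x with ⟨hx, hx'⟩ | ⟨hx, hx'⟩ <;> rcases hπ y with ⟨hy, hy'⟩ | ⟨hy, hy'⟩ <;>
      rw [hx', hy']
    · refine and_congr Iff.rfl ⟨fun h c h1 h2 => ?_, fun h c h1 h2 => ?_⟩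
      · rcases c with c | c
        · exact h c h1.2 h2.2
        · exact h c.1 h1 h2
      · by_cases hcb : c ≤ b
        · rcases hcb.lt_or_eq with hlt | rfl
          · exact h (Sum.inr ⟨c, hlt⟩) h1 h2
          · rw [hx.2, hy.2]
        · exact h (Sum.inl c) ⟨hcb, h1⟩ ⟨hcb, h2⟩
    · constructor
      · rintro ⟨he, h⟩
        refine ⟨⟨fun hyb => hy ⟨hyb, by rw [← h b hx.1 hyb, hx.2]⟩, he⟩, fun c h1 h2 => ?_⟩
        rcases c with c | c
        · exact h c h1.2 h2
        · exact h2.elim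
      · rintro ⟨⟨hyb, he⟩, h⟩
        refine ⟨he, fun c h1 h2 => ?_⟩
        exact h (Sum.inl c) ⟨fun hcb => hyb (G.mono c b hcb h2), h1⟩ h2
    · constructor
      · rintro ⟨he, h⟩
        refine ⟨⟨fun hxb => hx ⟨hxb, by rw [h b hxb hy.1, hy.2]⟩, he⟩, fun c h1 h2 => ?_⟩
        rcases c with c | c
        · exact h c h1 h2.2
        · exact h1.elim
      · rintro ⟨⟨hxb, he⟩, h⟩
        refine ⟨he, fun c h1 h2 => ?_⟩
        exact h (Sum.inl c) h1 ⟨fun hcb => hxb (G.mono c b hcb h1), h2⟩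
    · refine and_congr Iff.rfl ⟨fun h c h1 h2 => ?_, fun h c h1 h2 => h (Sum.inl c) h1 h2⟩
      rcases c with c | c
      · exact h c h1 h2
      · exact h1.elim
  · intro x y hxy h
    rcases hπ x with ⟨hx, hx'⟩ | ⟨hx, hx'⟩ <;> rcases hπ y with ⟨hy, hy'⟩ | ⟨hy, hy'⟩ <;>
      rw [hx', hy'] at hxy <;> rw [hx'] at h
    · refine I.inj x y (congrArg Subtype.val (Sum.inr.inj hxy)) fun c h1 => ?_
      by_cases hcb : c ≤ b
      · rcases hcb.lt_or_eq with hlt | rfl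
        · exact h (Sum.inr ⟨c, hlt⟩) h1
        · rw [hx.2, hy.2]
      · exact h (Sum.inl c) ⟨hcb, h1⟩
    · cases hxy
    · cases hxy
    · exact I.inj x y (Sum.inl.inj hxy) fun c h1 => h (Sum.inl c) h1
  · rintro (c | c) f g hfg
    · rintro ⟨h1, h2⟩
      refine ⟨I.congr _ _ _ (fun e he => hfg (Sum.inl e) he) h1, fun h => h2 ⟨h.1, ?_⟩⟩
      rw [hfg (Sum.inl b) h.1, h.2]
    · refine I.congr _ _ _ fun e he => ?_
      simp only [glue]
      split_ifs with h1 h2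
      · exact hfg (Sum.inr ⟨e, h1⟩) he
      · rfl
      · exact hfg (Sum.inl e) ⟨he, fun h => h.lt_or_eq.elim h1 h2⟩
  · intro x c hxc
    rcases hπ x with ⟨hx, hx'⟩ | ⟨hx, hx'⟩ <;> rw [hx'] at hxc
    · rcases c with c | c
      · exact ⟨I.mem x c hxc.2, fun h => hxc.1 h.1⟩
      · refine I.congr _ _ _ (fun e he => ?_) (I.mem x c.1 hxc)
        simp only [glue, cp]
        split_ifs with h1 h2
        · rfl
        · rw [h2, hx.2]
        · rfl
    · rcases c with c | c
      · exact ⟨I.mem x c hxc, fun h => hx ⟨G.mono c b h.1 hxc, h.2⟩⟩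
      · exact hxc.elim
  · rintro (v | v) g h
    · obtain ⟨x, h1, h2⟩ := I.sat v (fun e => g (Sum.inl e)) fun c hc => (h (Sum.inl c) hc).1
      refine ⟨x, ?_, ?_⟩
      · rcases hπ x with ⟨hx, hx'⟩ | ⟨hx, hx'⟩
        · refine absurd ⟨le_rfl, ?_⟩ (h (Sum.inl b) (h1 ▸ hx.1 : v ∈ G.content b)).2
          rw [← h2 b (h1 ▸ hx.1), hx.2]
        · rw [hx', h1]
      · rintro (c | c) hc
        · exact h2 c hc
        · exact hc.elim
    · obtain ⟨x, h1, h2⟩ := I.sat v.1 (glue g) (by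
        intro c hc
        by_cases hcb : c ≤ b
        · rcases hcb.lt_or_eq with hlt | rfl
          · exact h (Sum.inr ⟨c, hlt⟩) hc
          · refine I.congr _ _ _ (fun e he => ?_) hf₀
            obtain rfl := hmax e he
            simp [glue, a]
        · refine I.congr _ _ _ (fun e he => ?_) (h (Sum.inl c) ⟨hcb, hc⟩).1
          have heb : ¬ e ≤ b := fun h => hcb (he.trans h)
          simp only [glue]
          rw [dif_neg fun h => heb h.le, if_neg fun h => heb h.le])
      refine ⟨x, ?_, ?_⟩
      · have hx : I.π x ∈ G.content b ∧ I.ix x b = a := by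
          refine ⟨h1 ▸ v.2, ?_⟩
          rw [h2 b v.2]
          simp [glue]
        rcases hπ x with ⟨_, hx'⟩ | ⟨h, _⟩
        · rw [hx']; exact congrArg Sum.inr (Subtype.ext h1)
        · exact absurd hx h
      · rintro (c | c) hc
        · have := h2 c hc.2
          simp only [glue] at this
          rwa [dif_neg fun h => hc.1 h.le, if_neg fun h => hc.1 h.le] at this
        · have := h2 c.1 hc
          simp only [glue] at this
          rwa [dif_pos c.2] at this
  · rintro (c | c) g hg
    · obtain ⟨p, hp, rfl, h2⟩ := hl c _ hg.1
      refine ⟨(Sum.inl p.1, cp p.2), List.mem_filterMap.2 ⟨p, hp, ?_⟩, rfl, ?_⟩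
      · simp only [F]
        split_ifs with h3 h4 h5
        · exact absurd ⟨h4.le, by rw [← h3, h2 b h4.le]⟩ hg.2
        · exact absurd ⟨h5.le, by rw [← h3, h2 b h5.le]⟩ hg.2
        · rfl
        · rfl
      · rintro (e | e) he
        · exact h2 e he
        · exact he.elim
    · obtain ⟨p, hp, h1, h2⟩ := hl c.1 _ hg
      have hpb : p.1 < b := h1 ▸ c.2
      have hpa : p.2 b = a := by
        rw [h2 b c.2.le]
        simp [glue]
      refine ⟨(Sum.inr ⟨p.1, hpb⟩, cp p.2), List.mem_filterMap.2 ⟨p, hp, ?_⟩,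
        congrArg Sum.inr (Subtype.ext h1), ?_⟩
      · simp only [F]
        rw [if_pos hpa, dif_pos hpb]
      · rintro (e | e) he
        · have := h2 e he.1
          simp only [glue] at this
          rwa [dif_neg fun h => he.2 h.le, if_neg fun h => he.2 h.le] at this
        · have := h2 e.1 he
          simp only [glue] at this
          rwa [dif_pos e.2] at this
  · obtain ⟨p, hp, rfl, h2⟩ := hl b _ hf₀
    refine lt_of_le_of_ne (List.length_filterMap_le _ _) fun h => ?_
    have := List.filterMap_length_eq_length.1 h p hp
    simp [F, a, h2 p.1 le_rfl] at this

/-- Lexicographic induction on the length of the list of copies and the number of !-boxes. A maximal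
!-box that has a copy is expanded, which shortens the list. One that has none is killed, which
removes a !-box without lengthening the list. -/
theorem Instantiation.mem_language {G : BangGraph} {K : KGraph} (I : Instantiation G K)
    {l : List (G.Box × (G.Box → ℕ))} (hl : I.CoveredBy l) : K ∈ G.language := by
  classical
  suffices ∀ n m, ∀ (G : BangGraph) (I : Instantiation G K) (l : List (G.Box × (G.Box → ℕ))),
      I.CoveredBy l → l.length = n → Nat.card G.Box = m → K ∈ G.language from
    this _ _ G I l hl rfl rfl
  intro n
  induction n using Nat.strong_induction_on with
  | _ n ihn =>
  intro m
  induction m using Nat.strong_induction_on with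
  | _ m ihm =>
  intro G I l hl hn hm
  have := G.finite_Box
  rcases isEmpty_or_nonempty G.Box with he | ⟨⟨b₀⟩⟩
  · exact ⟨G, Reaches.refl, he, I.isoTo he⟩
  · obtain ⟨b, -, hb⟩ := exists_maximal_ge_of_wellFoundedGT (fun _ : G.Box => True) b₀ trivial
    by_cases hσ : ∃ f, I.σ b f
    · obtain ⟨f, hf⟩ := hσ
      obtain ⟨J, l', hl', hlt⟩ := I.exists_expand hl b
        (fun c hc => le_antisymm (hb.2 trivial hc) hc) f hf
      exact language_expand_subset G b (ihn l'.length (hn ▸ hlt) _ _ J l' hl' rfl rfl)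
    · obtain ⟨J, l', hl', hle⟩ := I.exists_kill hl b (not_exists.1 hσ)
      have hcard : Nat.card (G.kill b).Box < m := by
        rw [← hm]
        exact Finite.card_subtype_lt (x := b) (fun h => h le_rfl)
      apply language_kill_subset G b
      rcases (hn ▸ hle).lt_or_eq with hlt | heq
      · exact ihn _ hlt _ _ J l' hl' rfl rfl
      · exact ihm _ hcard _ J l' hl' heq rfl

theorem mem_language_iff {G : BangGraph} {K : KGraph} : K ∈ G.language ↔ G.IsInstance K := by
  refine ⟨isInstance_of_mem_language, fun h => ?_⟩
  obtain ⟨I, l, hl⟩ := h.exists_coveredBy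
  exact I.mem_language hl

end BangGraph

/-! ### Sentential forms as partial instances of a !-graph -/

namespace BangGraph

/-- The !-boxes that are open at the level `s`, where `none` stands for the outermost level. -/
def AtLevel (H : BangGraph) (s : Option H.Box) (b : H.Box) : Prop :=
  match s with
  | none => False
  | some d => d ≤ b

/-- The !-box `d` lies directly below the level `s`. -/
def Child (H : BangGraph) (s : Option H.Box) (d : H.Box) : Prop :=
  ¬ H.AtLevel s d ∧ ∀ e, d ≤ e ↔ e = d ∨ H.AtLevel s e

/-- The vertices which are contained in precisely the !-boxes that are open at the level `s`. -/
def own (H : BangGraph) (s : Option H.Box) : Set H.graph.V :=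
  {v | ∀ b, v ∈ H.content b ↔ H.AtLevel s b}

/-- Vertex labels which do not trigger the creation of edges. -/
def Inert (H : BangGraph) (k : H.graph.V) : Prop :=
  H.graph.lab k = VKind.node → ∀ w, H.graph.lab w = VKind.node

/-- The copy numbered `g` of a vertex `v` lies in open copies of !-boxes only, when the copies
numbered `f` of the !-boxes at the level `s` are open. -/
def Live (H : BangGraph) (s : Option H.Box) (f : H.Box → ℕ) (v : H.graph.V) (g : H.Box → ℕ) :
    Prop :=
  ∀ b, v ∈ H.content b → H.AtLevel s b ∧ g b = f b

theorem AtLevel.mono {H : BangGraph} {s : Option H.Box} {b c : H.Box} (h : H.AtLevel s b)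
    (hbc : b ≤ c) : H.AtLevel s c := by
  cases s with
  | none => exact h
  | some d => exact le_trans h hbc

theorem eq_of_atLevel_iff {H : BangGraph} {s s' : Option H.Box}
    (h : ∀ b, H.AtLevel s b ↔ H.AtLevel s' b) : s = s' := by
  rcases s with _ | d <;> rcases s' with _ | d'
  · rfl
  · exact ((h d').2 (le_refl d')).elim
  · exact ((h d).1 (le_refl d)).elim
  · exact congrArg some (le_antisymm ((h d').2 (le_refl d')) ((h d).1 (le_refl d)))

/-! ### Shapes of productions and the invariant of sentential forms -/

variable {H : BangGraph} {NT NF : Type}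

/-- `D` is the right-hand side of a production which creates the vertices in `O`, continues with the
nonterminal `Y`, and changes the labels of the old vertices by `rel`. -/
structure Shape (H : BangGraph) (α : H.graph.V → NF) (D : EGraph (VKind ⊕ NT) (Unit ⊕ NF))
    (Y : NT) (O : Set H.graph.V) (rel : H.graph.V → H.graph.V) where
  g : Option O ≃ D.V
  lab_nt : D.lab (g none) = Sum.inr Y
  lab : ∀ v, D.lab (g (some v)) = Sum.inl (H.graph.lab v.1)
  edge : ∀ v γ w, D.E (g (some v)) γ (g (some w)) ↔ γ = Sum.inl () ∧ H.graph.E v.1 () w.1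
  edge_to : ∀ v γ, D.E (g (some v)) γ (g none) ↔ γ = Sum.inr (α v.1)
  edge_from : ∀ v γ, D.E (g none) γ (g (some v)) ↔ γ = Sum.inr (α v.1)
  conn_nt : ∀ σ i γ d, D.C (Sum.inl σ) (Sum.inr (α i)) γ (g none) d ↔ γ = Sum.inr (α (rel i))
  conn_in : ∀ σ i γ v, D.C (Sum.inl σ) (Sum.inr (α i)) γ (g (some v)) EdgeDir.incoming ↔
    γ = Sum.inl () ∧ H.graph.lab i = VKind.node ∧ H.graph.E i () v.1
  conn_out : ∀ σ i γ v, D.C (Sum.inl σ) (Sum.inr (α i)) γ (g (some v)) EdgeDir.outgoing ↔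
    γ = Sum.inl () ∧ H.graph.lab i = VKind.node ∧ H.graph.E v.1 () i

/-- `X` consists of a nonterminal node labelled `Y` and copies of vertices of `H`. The copies
numbered `f` of the !-boxes at the level `s` are open. -/
structure Rep (H : BangGraph) (α : H.graph.V → NF) (X : EGraph (VKind ⊕ NT) (Unit ⊕ NF))
    (Y : NT) (s : Option H.Box) (f : H.Box → ℕ) where
  T : Type
  e : Option T ≃ X.V
  π : T → H.graph.V
  ix : T → H.Box → ℕ
  lbl : T → H.graph.V
  lab_nt : X.lab (e none) = Sum.inr Y
  lab : ∀ t, X.lab (e (some t)) = Sum.inl (H.graph.lab (π t))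
  edge : ∀ t γ u, X.E (e (some t)) γ (e (some u)) ↔ γ = Sum.inl () ∧
    H.graph.E (π t) () (π u) ∧ ∀ b, π t ∈ H.content b → π u ∈ H.content b → ix t b = ix u b
  edge_to : ∀ t γ, X.E (e (some t)) γ (e none) ↔ γ = Sum.inr (α (lbl t))
  edge_from : ∀ t γ, X.E (e none) γ (e (some t)) ↔ γ = Sum.inr (α (lbl t))
  inj : ∀ t u, π t = π u → (∀ b, π t ∈ H.content b → ix t b = ix u b) → t = u
  live : ∀ t, H.Live s f (π t) (ix t) → lbl t = π t
  inert : ∀ t, ¬ H.Live s f (π t) (ix t) → H.Inert (lbl t)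

variable {α : H.graph.V → NF} {X D : EGraph (VKind ⊕ NT) (Unit ⊕ NF)} {Y Y' : NT}
  {s s' : Option H.Box} {f f' : H.Box → ℕ} {O : Set H.graph.V} {rel : H.graph.V → H.graph.V}

/-- The sentential form consisting of one nonterminal node. -/
noncomputable def Rep.single (α : H.graph.V → NF) (Y : NT) (s : Option H.Box) (f : H.Box → ℕ) :
    Rep H α (EGraph.single (Sum.inr Y)) Y s f where
  T := Empty
  e := Equiv.ofBijective (fun _ => ()) ⟨fun x y _ => by
    rcases x with _ | ⟨⟨⟩⟩; rcases y with _ | ⟨⟨⟩⟩; rfl, fun x => ⟨none, rfl⟩⟩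
  π := Empty.elim
  ix := Empty.elim
  lbl := Empty.elim
  lab_nt := rfl
  lab := nofun
  edge := nofun
  edge_to := nofun
  edge_from := nofun
  inj := nofun
  live := nofun
  inert := nofun

theorem Rep.eq_of_isRight (R : Rep H α X Y s f) {x : X.V} (hx : (X.lab x).isRight) :
    x = R.e none := by
  obtain ⟨_ | t, rfl⟩ := R.e.surjective x
  · rfl
  · simp [R.lab] at hx

theorem Rep.exists_of_isLeft (R : Rep H α X Y s f) {x : X.V} (hx : (X.lab x).isLeft) :
    ∃ t, x = R.e (some t) := by
  obtain ⟨_ | t, rfl⟩ := R.e.surjective x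
  · simp [R.lab_nt] at hx
  · exact ⟨t, rfl⟩

/-- The effect of a production whose right-hand side has a nonterminal node. -/
noncomputable def Rep.subst (R : Rep H α X Y s f) (S : Shape H α D Y' O rel)
    (hO : ∀ v ∈ O, ∀ b, v ∈ H.content b → H.AtLevel s' b)
    (hlive : ∀ t, H.Live s' f' (R.π t) (R.ix t) → rel (R.lbl t) = R.π t)
    (hinert : ∀ t, ¬ H.Live s' f' (R.π t) (R.ix t) → H.Inert (rel (R.lbl t)))
    (hin : ∀ t, ∀ v ∈ O, (H.graph.lab (R.lbl t) = VKind.node ∧ H.graph.E (R.lbl t) () v) ↔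
      (H.graph.E (R.π t) () v ∧
        ∀ b, R.π t ∈ H.content b → v ∈ H.content b → R.ix t b = f' b))
    (hout : ∀ t, ∀ v ∈ O, (H.graph.lab (R.lbl t) = VKind.node ∧ H.graph.E v () (R.lbl t)) ↔
      (H.graph.E v () (R.π t) ∧
        ∀ b, v ∈ H.content b → R.π t ∈ H.content b → f' b = R.ix t b))
    (hfresh : ∀ t, ∀ v ∈ O, R.π t = v → ¬ ∀ b, v ∈ H.content b → R.ix t b = f' b) :
    Rep H α (X.subst (R.e none) D) Y' s' f' where
  T := R.T ⊕ O
  e := Equiv.ofBijective (fun x => match x with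
    | none => Sum.inr (S.g none)
    | some (Sum.inl t) => Sum.inl ⟨R.e (some t), fun h => by simpa using R.e.injective h⟩
    | some (Sum.inr v) => Sum.inr (S.g (some v))) (by
      constructor
      · rintro (_ | x | x) (_ | y | y) h
        · rfl
        · cases h
        · exact absurd (S.g.injective (Sum.inr.inj h)) (by simp)
        · cases h
        · have := R.e.injective (congrArg Subtype.val (Sum.inl.inj h))
          rw [Option.some.inj this]
        · cases h
        · exact absurd (S.g.injective (Sum.inr.inj h)) (by simp)
        · cases h
        · rw [Option.some.inj (S.g.injective (Sum.inr.inj h))]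
      · rintro (⟨u, hu⟩ | u)
        · obtain ⟨_ | t, rfl⟩ := R.e.surjective u
          · exact absurd rfl hu
          · exact ⟨some (Sum.inl t), rfl⟩
        · obtain ⟨_ | t, rfl⟩ := S.g.surjective u
          · exact ⟨none, rfl⟩
          · exact ⟨some (Sum.inr t), rfl⟩)
  π := Sum.elim R.π Subtype.val
  ix := Sum.elim R.ix fun _ => f'
  lbl := Sum.elim (fun t => rel (R.lbl t)) Subtype.val
  lab_nt := S.lab_nt
  lab t := by
    rcases t with t | t
    · exact R.lab t
    · exact S.lab t
  edge t γ u := by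
    rcases t with t | t <;> rcases u with u | u
    · exact R.edge t γ u
    · refine Iff.trans (b := ∃ β, X.E (R.e (some t)) β (R.e none) ∧
        D.C (X.lab (R.e (some t))) β γ (S.g (some u)) EdgeDir.incoming) Iff.rfl ?_
      simp only [R.edge_to, R.lab, exists_eq_left, S.conn_in]
      exact and_congr Iff.rfl (hin t u.1 u.2)
    · refine Iff.trans (b := ∃ β, X.E (R.e none) β (R.e (some u)) ∧
        D.C (X.lab (R.e (some u))) β γ (S.g (some t)) EdgeDir.outgoing) Iff.rfl ?_
      simp only [R.edge_from, R.lab, exists_eq_left, S.conn_out]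
      exact and_congr Iff.rfl (hout u t.1 t.2)
    · refine (S.edge t γ u).trans (and_congr Iff.rfl ?_)
      exact ⟨fun h => ⟨h, fun _ _ _ => rfl⟩, fun h => h.1⟩
  edge_to t γ := by
    rcases t with t | t
    · refine Iff.trans (b := ∃ β, X.E (R.e (some t)) β (R.e none) ∧
        D.C (X.lab (R.e (some t))) β γ (S.g none) EdgeDir.incoming) Iff.rfl ?_
      simp only [R.edge_to, R.lab, exists_eq_left, S.conn_nt]
      rfl
    · exact S.edge_to t γ
  edge_from t γ := by
    rcases t with t | t
    · refine Iff.trans (b := ∃ β, X.E (R.e none) β (R.e (some t)) ∧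
        D.C (X.lab (R.e (some t))) β γ (S.g none) EdgeDir.outgoing) Iff.rfl ?_
      simp only [R.edge_from, R.lab, exists_eq_left, S.conn_nt]
      rfl
    · exact S.edge_from t γ
  inj t u h hi := by
    rcases t with t | t <;> rcases u with u | u
    · exact congrArg Sum.inl (R.inj t u h hi)
    · exact absurd (fun b hb => hi b (h ▸ hb)) (hfresh t u.1 u.2 h)
    · exact absurd (fun b hb => (hi b hb).symm) (hfresh u t.1 t.2 h.symm)
    · exact congrArg Sum.inr (Subtype.ext h)
  live t ht := by
    rcases t with t | t
    · exact hlive t ht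
    · rfl
  inert t ht := by
    rcases t with t | t
    · exact hinert t ht
    · exact absurd (fun b hb => ⟨hO t.1 t.2 b hb, rfl⟩) ht

/-- Creation of the vertices belonging to the level `s`. -/
noncomputable def Rep.gen (R : Rep H α X Y s f) (S : Shape H α D Y' (H.own s) id)
    (hfresh : ∀ t, ¬ ∀ b, H.AtLevel s b → R.π t ∈ H.content b ∧ R.ix t b = f b) :
    Rep H α (X.subst (R.e none) D) Y' s f :=
  -- If the old end were a wire-vertex, openness would place it in every !-box of `v` with the
  -- current numbers, against `hfresh`. So it is a node-vertex and `v` is a wire-vertex; then `v`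
  -- lies in every !-box of the old end, and all of these are therefore open.
  have key : ∀ t, ∀ v ∈ H.own s, (H.graph.E (R.π t) () v ∨ H.graph.E v () (R.π t)) →
      (∀ b, R.π t ∈ H.content b → v ∈ H.content b → R.ix t b = f b) →
      H.graph.lab (R.π t) = VKind.node ∧ H.Live s f (R.π t) (R.ix t) := by
    intro t v hv hE hi
    have h1 : H.graph.lab (R.π t) = VKind.node := by
      cases hw : H.graph.lab (R.π t) with
      | node => rfl
      | wire =>
        refine absurd (fun b hb => ?_) (hfresh t)
        have hvb : v ∈ H.content b := (hv b).2 hb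
        have : R.π t ∈ H.content b := hE.elim
          (fun h => (H.isOpen b).out_mem H.isString hw hvb h)
          (fun h => (H.isOpen b).in_mem H.isString hw hvb h)
        exact ⟨this, hi b this hvb⟩
    refine ⟨h1, fun b hb => ?_⟩
    have hw : H.graph.lab v = VKind.wire := by
      cases hw : H.graph.lab v with
      | wire => rfl
      | node => exact (hE.elim (H.isString.node_node _ _ h1 hw)
          (H.isString.node_node _ _ hw h1)).elim
    have hvb : v ∈ H.content b := hE.elim
      (fun h => (H.isOpen b).in_mem H.isString hw hb h)
      (fun h => (H.isOpen b).out_mem H.isString hw hb h)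
    exact ⟨(hv b).1 hvb, hi b hb hvb⟩
  -- Conversely, a label that triggers an edge belongs to a live vertex: a node-vertex label is
  -- inert only if `H` has no wire-vertices, and then it has no edges.
  have key' : ∀ t v, (H.graph.E (R.lbl t) () v ∨ H.graph.E v () (R.lbl t)) →
      H.graph.lab (R.lbl t) = VKind.node → H.Live s f (R.π t) (R.ix t) := by
    intro t v hE hn
    by_contra hl
    have hall := R.inert t hl hn
    exact hE.elim (H.isString.node_node _ _ hn (hall v)) (H.isString.node_node _ _ (hall v) hn)
  R.subst S (fun v hv b hb => (hv b).1 hb) R.live R.inert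
    (fun t v hv => by
      constructor
      · rintro ⟨h1, h2⟩
        have hl := key' t v (Or.inl h2) h1
        exact ⟨R.live t hl ▸ h2, fun b hb _ => (hl b hb).2⟩
      · rintro ⟨h1, h2⟩
        obtain ⟨hn, hl⟩ := key t v hv (Or.inl h1) h2
        rw [R.live t hl]
        exact ⟨hn, h1⟩)
    (fun t v hv => by
      constructor
      · rintro ⟨h1, h2⟩
        have hl := key' t v (Or.inr h2) h1
        exact ⟨R.live t hl ▸ h2, fun b _ hb => (hl b hb).2.symm⟩
      · rintro ⟨h1, h2⟩
        obtain ⟨hn, hl⟩ := key t v hv (Or.inr h1) fun b hb hb' => (h2 b hb' hb).symm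
        rw [R.live t hl]
        exact ⟨hn, h1⟩)
    (fun t v hv h h' => hfresh t fun b hb => by
      have hvb := (hv b).2 hb
      exact ⟨h ▸ hvb, h' b hvb⟩)

/-- Passing to a new copy of the !-box `d` below the level `s`. -/
noncomputable def Rep.call {d : H.Box} (R : Rep H α X Y s f) (S : Shape H α D Y' ∅ id)
    (hd : H.Child s d) (hf : ∀ b, H.AtLevel s b → f' b = f b)
    (hfresh : ∀ t, ¬ ∀ b, d ≤ b → R.π t ∈ H.content b ∧ R.ix t b = f' b) :
    Rep H α (X.subst (R.e none) D) Y' (some d) f' :=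
  -- Opening an untouched copy of `d` changes nothing for old vertices. An old vertex that became
  -- live through `d` would already lie in that copy, against `hfresh`.
  have key : ∀ t, H.Live (some d) f' (R.π t) (R.ix t) ↔ H.Live s f (R.π t) (R.ix t) := by
    intro t
    constructor
    · intro h b hb
      have h1 := h b hb
      rcases (hd.2 b).1 h1.1 with rfl | h2
      · refine absurd (fun c hc => ?_) (hfresh t)
        have := H.mono _ _ hc hb
        exact ⟨this, (h c this).2⟩
      · exact ⟨h2, h1.2.trans (hf b h2)⟩
    · intro h b hb
      have h1 := h b hb
      exact ⟨(hd.2 b).2 (Or.inr h1.1), h1.2.trans (hf b h1.1).symm⟩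
  R.subst S (fun v hv => hv.elim) (fun t ht => R.live t ((key t).1 ht))
    (fun t ht => R.inert t fun h => ht ((key t).2 h)) (fun t v hv => hv.elim)
    (fun t v hv => hv.elim) (fun t v hv => hv.elim)

/-- Returning from a copy of the !-box `d` to the level `s`. -/
noncomputable def Rep.close {d : H.Box} (R : Rep H α X Y (some d) f) (S : Shape H α D Y' ∅ rel)
    (hd : H.Child s d) (hout : ∀ v, v ∉ H.content d → rel v = v)
    (hin : ∀ v ∈ H.content d, H.Inert (rel v)) :
    Rep H α (X.subst (R.e none) D) Y' s f :=
  R.subst S (fun v hv => hv.elim)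
    (fun t ht => by
      have h1 : R.lbl t = R.π t :=
        R.live t fun b hb => ⟨(hd.2 b).2 (Or.inr (ht b hb).1), (ht b hb).2⟩
      rw [h1]
      exact hout _ fun h => hd.1 (ht d h).1)
    (fun t ht => by
      by_cases hl : R.lbl t ∈ H.content d
      · exact hin _ hl
      · rw [hout _ hl]
        -- If `t` was live inside the copy of `d`, its label is its own vertex, which lies outside
        -- `d`. Then it is live at the level `s` too, contrary to assumption.
        refine R.inert t fun h => ht fun b hb => ?_
        rw [R.live t h] at hl
        refine ⟨((hd.2 b).1 (h b hb).1).resolve_left fun hbd => hl (hbd ▸ hb), (h b hb).2⟩)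
    (fun t v hv => hv.elim) (fun t v hv => hv.elim) (fun t v hv => hv.elim)

/-- Removal of the nonterminal node. -/
theorem Rep.exists_final (R : Rep H α X Y s f) (hD : IsEmpty D.V) :
    ∃ ψ : R.T ≃ (X.subst (R.e none) D).V,
      (∀ t, (X.subst (R.e none) D).lab (ψ t) = Sum.inl (H.graph.lab (R.π t))) ∧
      ∀ t γ u, (X.subst (R.e none) D).E (ψ t) γ (ψ u) ↔ γ = Sum.inl () ∧
        H.graph.E (R.π t) () (R.π u) ∧
        ∀ b, R.π t ∈ H.content b → R.π u ∈ H.content b → R.ix t b = R.ix u b := by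
  refine ⟨Equiv.ofBijective
    (fun t => Sum.inl ⟨R.e (some t), fun h => by simpa using R.e.injective h⟩) ⟨?_, ?_⟩,
    R.lab, R.edge⟩
  · intro t u h
    exact Option.some.inj (R.e.injective (congrArg Subtype.val (Sum.inl.inj h)))
  · rintro (⟨u, hu⟩ | u)
    · obtain ⟨_ | t, rfl⟩ := R.e.surjective u
      · exact absurd rfl hu
      · exact ⟨t, rfl⟩
    · exact hD.elim u

end BangGraph

/-! ### Grammars that traverse the copies of the !-boxes of a !-graph -/

namespace BangGraph

/-- The grammar `𝒢` generates the instances of `H` by a depth-first traversal of the copies of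
!-boxes. The nonterminal `op s` is used before and `st s` after the creation of the vertices that
belong to the level `s`. -/
structure Traversal (H : BangGraph) (𝒢 : EdNCE VKind Unit) where
  α : H.graph.V → 𝒢.NF
  op : Option H.Box → 𝒢.NT
  st : Option H.Box → 𝒢.NT
  rel : H.Box → H.graph.V → H.graph.V
  op_inj : ∀ s s', op s = op s' → s = s'
  st_inj : ∀ s s', st s = st s' → s = s'
  op_ne_st : ∀ s s', op s ≠ st s'
  rel_out : ∀ d v, v ∉ H.content d → rel d v = v
  rel_in : ∀ d, ∀ v ∈ H.content d, H.Inert (rel d v)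
  start : 𝒢.start = op none
  cases : ∀ p,
    (∃ s, 𝒢.lhs p = op s ∧ Nonempty (Shape H α (𝒢.rhs p) (st s) (H.own s) id)) ∨
    (∃ s d, H.Child s d ∧ 𝒢.lhs p = st s ∧ Nonempty (Shape H α (𝒢.rhs p) (op (some d)) ∅ id)) ∨
    (∃ s d, H.Child s d ∧ 𝒢.lhs p = st (some d) ∧
      Nonempty (Shape H α (𝒢.rhs p) (st s) ∅ (rel d))) ∨
    (𝒢.lhs p = st none ∧ IsEmpty (𝒢.rhs p).V)
  exists_gen : ∀ s, ∃ p, 𝒢.lhs p = op s ∧ Nonempty (Shape H α (𝒢.rhs p) (st s) (H.own s) id)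
  exists_call : ∀ s d, H.Child s d →
    ∃ p, 𝒢.lhs p = st s ∧ Nonempty (Shape H α (𝒢.rhs p) (op (some d)) ∅ id)
  exists_close : ∀ s d, H.Child s d →
    ∃ p, 𝒢.lhs p = st (some d) ∧ Nonempty (Shape H α (𝒢.rhs p) (st s) ∅ (rel d))
  exists_final : ∃ p, 𝒢.lhs p = st none ∧ IsEmpty (𝒢.rhs p).V
  gen_unique : ∀ s p p', 𝒢.lhs p = op s → 𝒢.lhs p' = op s → p = p'
  final_unique : ∀ p p', IsEmpty (𝒢.rhs p).V → IsEmpty (𝒢.rhs p').V → p = p'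

variable {H : BangGraph} {𝒢 : EdNCE VKind Unit}

/-- The copies of !-boxes described by `σ` are consistent with the copies of vertices. -/
structure IsPartialInstance (H : BangGraph) {T : Type} (π : T → H.graph.V) (ix : T → H.Box → ℕ)
    (σ : H.Box → (H.Box → ℕ) → Prop) : Prop where
  congr : ∀ b f g, (∀ c, b ≤ c → f c = g c) → σ b f → σ b g
  up : ∀ b c f, b ≤ c → σ b f → σ c f
  mem : ∀ t b, π t ∈ H.content b → σ b (ix t)
  bounded : ∃ N, ∀ b f, σ b f → f b < N

/-- Saturation can be kept throughout a derivation because a copy is entered into `σ` only when its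
vertices are created, not already when the nonterminal calls it. -/
def IsSaturated (H : BangGraph) {T : Type} (π : T → H.graph.V) (ix : T → H.Box → ℕ)
    (σ : H.Box → (H.Box → ℕ) → Prop) : Prop :=
  ∀ v f, (∀ b, v ∈ H.content b → σ b f) →
    ∃ t, π t = v ∧ ∀ b, v ∈ H.content b → ix t b = f b

/-! ### Soundness: derived graphs are instances, and the !-linear form -/

namespace Traversal

variable (𝒯 : Traversal H 𝒢)

/-- The possible sentential forms. -/
inductive Sound (X : EGraph (VKind ⊕ 𝒢.NT) (Unit ⊕ 𝒢.NF)) : Prop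
  | init (f : H.Box → ℕ) (R : Rep H 𝒯.α X (𝒯.op none) none f) (hR : IsEmpty R.T)
  | op (d : H.Box) (f : H.Box → ℕ) (R : Rep H 𝒯.α X (𝒯.op (some d)) (some d) f)
      (σ : H.Box → (H.Box → ℕ) → Prop) (hσ : IsPartialInstance H R.π R.ix σ)
      (hs : IsSaturated H R.π R.ix σ) (hd : ¬ σ d f) (hup : ∀ b, d < b → σ b f)
  | st (s : Option H.Box) (f : H.Box → ℕ) (R : Rep H 𝒯.α X (𝒯.st s) s f)
      (σ : H.Box → (H.Box → ℕ) → Prop) (hσ : IsPartialInstance H R.π R.ix σ)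
      (hs : IsSaturated H R.π R.ix σ) (hup : ∀ b, H.AtLevel s b → σ b f)
  | final (h : ∀ x, (X.lab x).isLeft)
      (hK : ∀ K : KGraph, X.toLGraph.IsoTo (K.extend 𝒢.NT 𝒢.NF) → H.IsInstance K)

variable {𝒯} {X : EGraph (VKind ⊕ 𝒢.NT) (Unit ⊕ 𝒢.NF)}

theorem sound_gen_none {f : H.Box → ℕ} (R : Rep H 𝒯.α X (𝒯.op none) none f) (hR : IsEmpty R.T)
    {D : EGraph (VKind ⊕ 𝒢.NT) (Unit ⊕ 𝒢.NF)}
    (S : Shape H 𝒯.α D (𝒯.st none) (H.own none) id) :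
    𝒯.Sound (X.subst (R.e none) D) := by
  refine .st none f (R.gen S fun t => hR.elim t) (fun _ _ => False) ⟨?_, ?_, ?_, ?_⟩ ?_ ?_
  · exact fun _ _ _ _ h => h
  · exact fun _ _ _ _ h => h
  · rintro (t | t) b hb
    · exact hR.elim t
    · exact (t.2 b).1 hb
  · exact ⟨0, fun _ _ h => h.elim⟩
  · intro v g h
    exact ⟨Sum.inr ⟨v, fun b => ⟨h b, fun h => h.elim⟩⟩, rfl, fun b hb => (h b hb).elim⟩
  · exact fun _ h => h

/-- Recording copy `f` of `d` adds demands only for vertices that lie in exactly the !-boxes above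
or equal to `d`, and these are the vertices just created. The absence of overlaps is what excludes
further demands. -/
theorem sound_gen_some (hH : H.NoOverlap) {d : H.Box} {f : H.Box → ℕ}
    (R : Rep H 𝒯.α X (𝒯.op (some d)) (some d) f)
    {σ : H.Box → (H.Box → ℕ) → Prop} (hσ : IsPartialInstance H R.π R.ix σ)
    (hs : IsSaturated H R.π R.ix σ) (hd : ¬ σ d f) (hup : ∀ b, d < b → σ b f)
    {D : EGraph (VKind ⊕ 𝒢.NT) (Unit ⊕ 𝒢.NF)}
    (S : Shape H 𝒯.α D (𝒯.st (some d)) (H.own (some d)) id) :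
    𝒯.Sound (X.subst (R.e none) D) := by
  have hfr : ∀ t, ¬ ∀ b, H.AtLevel (some d) b → R.π t ∈ H.content b ∧ R.ix t b = f b := by
    intro t h
    exact hd (hσ.congr d _ _ (fun c hc => (h c hc).2) (hσ.mem t d (h d (le_refl d)).1))
  have hnew : ∀ b, d ≤ b → σ b f ∨ b = d ∧ ∀ c, d ≤ c → f c = f c := fun b hb =>
    hb.lt_or_eq.elim (fun h => Or.inl (hup b h)) (fun h => Or.inr ⟨h.symm, fun _ _ => rfl⟩)
  refine .st (some d) f (R.gen S hfr) (fun b g => σ b g ∨ b = d ∧ ∀ c, d ≤ c → g c = f c)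
    ⟨?_, ?_, ?_, ?_⟩ ?_ hnew
  · rintro b g g' h (h1 | ⟨rfl, h1⟩)
    · exact Or.inl (hσ.congr _ _ _ h h1)
    · exact Or.inr ⟨rfl, fun c hc => (h c hc).symm.trans (h1 c hc)⟩
  · rintro b c g hbc (h1 | ⟨rfl, h1⟩)
    · exact Or.inl (hσ.up _ _ _ hbc h1)
    · rcases hbc.lt_or_eq with h2 | rfl
      · exact Or.inl (hσ.congr _ _ _ (fun e he => (h1 e (hbc.trans he)).symm) (hup c h2))
      · exact Or.inr ⟨rfl, h1⟩
  · rintro (t | t) b hb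
    · exact Or.inl (hσ.mem t b hb)
    · exact hnew b ((t.2 b).1 hb)
  · obtain ⟨N, hN⟩ := hσ.bounded
    refine ⟨max N (f d + 1), ?_⟩
    rintro b g (h | ⟨rfl, h⟩)
    · exact lt_max_of_lt_left (hN b g h)
    · rw [h b le_rfl]
      exact lt_max_of_lt_right (Nat.lt_succ_self _)
  · intro v g h
    by_cases hall : ∀ b, v ∈ H.content b → σ b g
    · obtain ⟨t, h1, h2⟩ := hs v g hall
      exact ⟨Sum.inl t, h1, h2⟩
    · push Not at hall
      obtain ⟨b, hb, hbσ⟩ := hall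
      obtain ⟨rfl, hg⟩ := (h b hb).resolve_left hbσ
      -- Here `b` is the !-box being entered. Any other !-box around `v` is comparable with it, as
      -- there are no overlaps. One strictly below would have a copy recorded in `σ`, and by `up` so
      -- would `b`, against `hbσ`.
      have hown : v ∈ H.own (some b) := by
        intro c
        refine ⟨fun hc => ?_, fun hc => H.mono b c hc hb⟩
        by_contra hbc
        have hcb : c ≤ b := by
          by_contra hcb
          exact hH b c ⟨hbc, hcb, v, hb, hc⟩
        refine hbσ ?_
        rcases h c hc with h1 | ⟨rfl, -⟩
        · exact hσ.up _ _ _ hcb h1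
        · exact absurd le_rfl hbc
      exact ⟨Sum.inr ⟨v, hown⟩, rfl, fun c hc => (hg c ((hown c).1 hc)).symm⟩

/-- The bound `N` on recorded numbers is itself an unused number for the new copy of `d`. Thus no
old vertex lies in that copy, whereas the enclosing copies keep their numbers. -/
theorem sound_call {s : Option H.Box} {d : H.Box} {f : H.Box → ℕ}
    (R : Rep H 𝒯.α X (𝒯.st s) s f)
    {σ : H.Box → (H.Box → ℕ) → Prop} (hσ : IsPartialInstance H R.π R.ix σ)
    (hs : IsSaturated H R.π R.ix σ) (hup : ∀ b, H.AtLevel s b → σ b f) (hd : H.Child s d)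
    {D : EGraph (VKind ⊕ 𝒢.NT) (Unit ⊕ 𝒢.NF)}
    (S : Shape H 𝒯.α D (𝒯.op (some d)) ∅ id) :
    𝒯.Sound (X.subst (R.e none) D) := by
  classical
  obtain ⟨N, hN⟩ := hσ.bounded
  have hne : ∀ b, H.AtLevel s b → b ≠ d := fun b hb h => hd.1 (h ▸ hb)
  have hf : ∀ b, H.AtLevel s b → Function.update f d N b = f b := fun b hb =>
    Function.update_of_ne (hne b hb) _ _
  have hfr : ∀ t, ¬ ∀ b, d ≤ b → R.π t ∈ H.content b ∧ R.ix t b = Function.update f d N b := by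
    intro t h
    have h1 := h d le_rfl
    rw [Function.update_self] at h1
    exact absurd (hN d _ (hσ.mem t d h1.1)) (by omega)
  refine .op d (Function.update f d N) (R.call S hd hf hfr) σ ⟨hσ.congr, hσ.up, ?_, hσ.bounded⟩
    ?_ ?_ ?_
  · rintro (t | t) b hb
    · exact hσ.mem t b hb
    · exact t.2.elim
  · intro v g h
    obtain ⟨t, h1, h2⟩ := hs v g h
    exact ⟨Sum.inl t, h1, h2⟩
  · intro h
    have := hN d _ h
    rw [Function.update_self] at this
    omega
  · intro b hb
    have h1 : ∀ c, b ≤ c → H.AtLevel s c := fun c hc =>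
      ((hd.2 c).1 (hb.le.trans hc)).resolve_left fun h => absurd (h ▸ hc) hb.not_ge
    exact hσ.congr _ _ _ (fun c hc => (hf c (h1 c hc)).symm) (hup b (h1 b le_rfl))

theorem sound_close {s : Option H.Box} {d : H.Box} {f : H.Box → ℕ}
    (R : Rep H 𝒯.α X (𝒯.st (some d)) (some d) f)
    {σ : H.Box → (H.Box → ℕ) → Prop} (hσ : IsPartialInstance H R.π R.ix σ)
    (hs : IsSaturated H R.π R.ix σ) (hup : ∀ b, H.AtLevel (some d) b → σ b f) (hd : H.Child s d)
    {D : EGraph (VKind ⊕ 𝒢.NT) (Unit ⊕ 𝒢.NF)}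
    (S : Shape H 𝒯.α D (𝒯.st s) ∅ (𝒯.rel d)) :
    𝒯.Sound (X.subst (R.e none) D) := by
  refine .st s f (R.close S hd (𝒯.rel_out d) (𝒯.rel_in d)) σ ⟨hσ.congr, hσ.up, ?_, hσ.bounded⟩ ?_ ?_
  · rintro (t | t) b hb
    · exact hσ.mem t b hb
    · exact t.2.elim
  · intro v g h
    obtain ⟨t, h1, h2⟩ := hs v g h
    exact ⟨Sum.inl t, h1, h2⟩
  · exact fun b hb => hup b ((hd.2 b).2 (Or.inr hb))

/-- Deleting the nonterminal node leaves the terminal nodes and their edges untouched, so the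
recorded `σ` serves as that of an instance. -/
theorem sound_final {f : H.Box → ℕ} {Y : 𝒢.NT} {s : Option H.Box} (R : Rep H 𝒯.α X Y s f)
    {σ : H.Box → (H.Box → ℕ) → Prop} (hσ : IsPartialInstance H R.π R.ix σ)
    (hs : IsSaturated H R.π R.ix σ) {D : EGraph (VKind ⊕ 𝒢.NT) (Unit ⊕ 𝒢.NF)}
    (hD : IsEmpty D.V) : 𝒯.Sound (X.subst (R.e none) D) := by
  obtain ⟨ψ, hlab, hE⟩ := R.exists_final hD
  refine .final (fun x => ?_) fun K hK => ?_
  · obtain ⟨t, rfl⟩ := ψ.surjective x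
    simp [hlab]
  · obtain ⟨e, hl, he⟩ := hK
    let φ : R.T ≃ K.V := ψ.trans e
    have h1 : ∀ t, K.lab (φ t) = H.graph.lab (R.π t) := fun t =>
      Sum.inl.inj ((hl (ψ t)).trans (hlab t))
    have h2 : ∀ t u, K.E (φ t) () (φ u) ↔ H.graph.E (R.π t) () (R.π u) ∧
        ∀ b, R.π t ∈ H.content b → R.π u ∈ H.content b → R.ix t b = R.ix u b := by
      intro t u
      have h3 := (he (ψ t) (Sum.inl ()) (ψ u)).trans (hE t (Sum.inl ()) u)
      refine Iff.trans ⟨fun h => ?_, fun h => ?_⟩ (h3.trans (and_iff_right rfl))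
      · exact ⟨(), rfl, h⟩
      · obtain ⟨_, _, h⟩ := h
        exact h
    refine ⟨⟨fun x => R.π (φ.symm x), fun x => R.ix (φ.symm x), σ, ?_, ?_, ?_, hσ.congr, ?_, ?_⟩⟩
    · intro x
      rw [← h1, φ.apply_symm_apply]
    · intro x y
      rw [← h2, φ.apply_symm_apply, φ.apply_symm_apply]
    · intro x y h h'
      exact φ.symm.injective (R.inj _ _ h h')
    · exact fun x b hb => hσ.mem _ b hb
    · intro v g h
      obtain ⟨t, h3, h4⟩ := hs v g h
      exact ⟨φ t, by simpa using h3, by simpa using h4⟩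

/-- The label of the nonterminal node determines the state and the level, by injectivity and
disjointness of `op` and `st`. Hence each production can only act in the state for which it is
designed. -/
theorem sound_of_derives (hH : H.NoOverlap) (𝒯 : Traversal H 𝒢) (h : 𝒢.Derives X) :
    𝒯.Sound X := by
  induction h with
  | start =>
    rw [𝒯.start]
    exact .init (fun _ => 0) (Rep.single 𝒯.α (𝒯.op none) none fun _ => 0)
      (inferInstanceAs (IsEmpty Empty))
  | step X v p _ hv ih =>
    have hr : (X.lab v).isRight := by rw [hv]; rfl
    have hc := 𝒯.cases p
    cases ih with
    | init f R hR =>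
      obtain rfl := R.eq_of_isRight hr
      have hl : 𝒢.lhs p = 𝒯.op none := Sum.inr.inj (hv.symm.trans R.lab_nt)
      rw [hl] at hc
      rcases hc with ⟨s, h1, ⟨S⟩⟩ | ⟨s, d, -, h1, -⟩ | ⟨s, d, -, h1, -⟩ | ⟨h1, -⟩
      · obtain rfl := 𝒯.op_inj _ _ h1
        exact sound_gen_none R hR S
      · exact absurd h1 (𝒯.op_ne_st _ _)
      · exact absurd h1 (𝒯.op_ne_st _ _)
      · exact absurd h1 (𝒯.op_ne_st _ _)
    | op d f R σ hσ hs hd hup =>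
      obtain rfl := R.eq_of_isRight hr
      have hl : 𝒢.lhs p = 𝒯.op (some d) := Sum.inr.inj (hv.symm.trans R.lab_nt)
      rw [hl] at hc
      rcases hc with ⟨s, h1, ⟨S⟩⟩ | ⟨s, d, -, h1, -⟩ | ⟨s, d, -, h1, -⟩ | ⟨h1, -⟩
      · obtain rfl := 𝒯.op_inj _ _ h1
        exact sound_gen_some hH R hσ hs hd hup S
      · exact absurd h1 (𝒯.op_ne_st _ _)
      · exact absurd h1 (𝒯.op_ne_st _ _)
      · exact absurd h1 (𝒯.op_ne_st _ _)
    | st s f R σ hσ hs hup =>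
      obtain rfl := R.eq_of_isRight hr
      have hl : 𝒢.lhs p = 𝒯.st s := Sum.inr.inj (hv.symm.trans R.lab_nt)
      rw [hl] at hc
      rcases hc with ⟨s', h1, -⟩ | ⟨s', d, hd, h1, ⟨S⟩⟩ | ⟨s', d, hd, h1, ⟨S⟩⟩ | ⟨h1, hD⟩
      · exact absurd h1.symm (𝒯.op_ne_st _ _)
      · obtain rfl := 𝒯.st_inj _ _ h1
        exact sound_call R hσ hs hup hd S
      · obtain rfl := 𝒯.st_inj _ _ h1
        exact sound_close R hσ hs hup hd S
      · exact sound_final R hσ hs hD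
    | final h _ =>
      have := h v
      rw [hv] at this
      cases this

theorem Sound.exists_rep (h : 𝒯.Sound X) {x : X.V} (hx : (X.lab x).isRight) :
    ∃ Y s f, Nonempty (Rep H 𝒯.α X Y s f) := by
  cases h with
  | init f R _ => exact ⟨_, _, _, ⟨R⟩⟩
  | op _ _ R => exact ⟨_, _, _, ⟨R⟩⟩
  | st _ _ R => exact ⟨_, _, _, ⟨R⟩⟩
  | final h _ =>
    have := h x
    cases hX : X.lab x <;> simp [hX] at hx this

theorem isInstance_of_mem_language (hH : H.NoOverlap) (𝒯 : Traversal H 𝒢) {K : KGraph}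
    (hK : K ∈ 𝒢.language) : H.IsInstance K := by
  obtain ⟨X, hX, hi⟩ := hK
  have hleft : ∀ x, (X.lab x).isLeft := by
    obtain ⟨e, hl, -⟩ := hi
    intro x
    rw [← hl x]
    rfl
  have hno : ∀ {Y s f}, Rep H 𝒯.α X Y s f → False := fun R => by
    have := hleft (R.e none)
    rw [R.lab_nt] at this
    cases this
  cases sound_of_derives hH 𝒯 hX with
  | init f R _ => exact (hno R).elim
  | op _ _ R => exact (hno R).elim
  | st _ _ R => exact (hno R).elim
  | final _ h => exact h K hi

/-- The !-linear form. -/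
theorem isBangLinear (hH : H.NoOverlap) (𝒯 : Traversal H 𝒢) (α : H.graph.V ↪ 𝒢.NF)
    (hα : ∀ v, α v = 𝒯.α v) : 𝒢.IsBangLinear α := by
  have hshape : ∀ p, (∃ Y O rel, Nonempty (Shape H 𝒯.α (𝒢.rhs p) Y O rel)) ∨
      IsEmpty (𝒢.rhs p).V := by
    intro p
    rcases 𝒯.cases p with ⟨s, -, h⟩ | ⟨s, d, -, -, h⟩ | ⟨s, d, -, -, h⟩ | ⟨-, h⟩
    · exact Or.inl ⟨_, _, _, h⟩
    · exact Or.inl ⟨_, _, _, h⟩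
    · exact Or.inl ⟨_, _, _, h⟩
    · exact Or.inr h
  have hright : ∀ {p Y O rel} (S : Shape H 𝒯.α (𝒢.rhs p) Y O rel) x,
      ((𝒢.rhs p).lab x).isRight → x = S.g none := by
    intro p Y O rel S x hx
    obtain ⟨_ | v, rfl⟩ := S.g.surjective x
    · rfl
    · simp [S.lab] at hx
  have hfinal : ∀ p, 𝒢.IsFinal p → IsEmpty (𝒢.rhs p).V := by
    intro p hp
    rcases hshape p with ⟨Y, O, rel, ⟨S⟩⟩ | h
    · have := hp (S.g none)
      rw [S.lab_nt] at this
      cases this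
    · exact h
  refine ⟨?_, ?_, hfinal, ?_, ?_, ?_, ?_⟩
  · intro p x hx y hy
    rcases hshape p with ⟨Y, O, rel, ⟨S⟩⟩ | h
    · rw [hright S x hx, hright S y hy]
    · exact h.elim x
  · obtain ⟨p, -, hp⟩ := 𝒯.exists_final
    exact ⟨p, fun x => hp.elim x, fun q hq => 𝒯.final_unique q p (hfinal q hq) hp⟩
  · intro X hX x v hx hv
    obtain ⟨Y, s, f, ⟨R⟩⟩ := (sound_of_derives hH 𝒯 hX).exists_rep hx
    obtain rfl := R.eq_of_isRight hx
    obtain ⟨t, rfl⟩ := R.exists_of_isLeft hv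
    refine ⟨R.lbl t, ?_, ?_⟩
    · rw [R.edge_to, hα]
    · rw [R.edge_from, hα]
  · intro X hX x v γ hx hv he
    obtain ⟨Y, s, f, ⟨R⟩⟩ := (sound_of_derives hH 𝒯 hX).exists_rep hx
    obtain rfl := R.eq_of_isRight hx
    obtain ⟨t, rfl⟩ := R.exists_of_isLeft hv
    rw [R.edge_to, R.edge_from, or_self] at he
    exact ⟨R.lbl t, by rw [hα]; exact he⟩
  · intro p _ x hx i
    rcases hshape p with ⟨Y, O, rel, ⟨S⟩⟩ | h
    · obtain rfl := hright S x hx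
      refine ⟨rel i, fun σ d => ?_⟩
      rw [hα, hα, S.conn_nt]
    · exact h.elim x
  -- Edges among terminal nodes carry the final label, so `α i` occurs only on the edges joining the
  -- node created for `i` to the nonterminal node.
  · have hinc : ∀ {p Y O rel} (S : Shape H 𝒯.α (𝒢.rhs p) Y O rel) x i,
        ((𝒢.rhs p).lab x).isLeft → (∃ u, (𝒢.rhs p).E x (Sum.inr (α i)) u ∨
          (𝒢.rhs p).E u (Sum.inr (α i)) x) → ∃ h : i ∈ O, x = S.g (some ⟨i, h⟩) := by
      rintro p Y O rel S x i hx ⟨u, hu⟩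
      obtain ⟨_ | v, rfl⟩ := S.g.surjective x
      · simp [S.lab_nt] at hx
      · obtain ⟨_ | w, rfl⟩ := S.g.surjective u
        · rw [S.edge_to, S.edge_from, or_self, ← hα] at hu
          obtain rfl := α.injective (Sum.inr.inj hu)
          exact ⟨v.2, rfl⟩
        · simp [S.edge] at hu
    have hgen : ∀ i (p : 𝒢.Prd) (x : (𝒢.rhs p).V), ((𝒢.rhs p).lab x).isLeft →
        (∃ u, (𝒢.rhs p).E x (Sum.inr (α i)) u ∨ (𝒢.rhs p).E u (Sum.inr (α i)) x) →
        ∃ s, 𝒢.lhs p = 𝒯.op s ∧ i ∈ H.own s := by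
      intro i p x hx hu
      rcases 𝒯.cases p with ⟨s, h, ⟨S⟩⟩ | ⟨s, d, -, -, ⟨S⟩⟩ | ⟨s, d, -, -, ⟨S⟩⟩ | ⟨-, h⟩
      · exact ⟨s, h, (hinc S x i hx hu).1⟩
      · exact ((hinc S x i hx hu).1).elim
      · exact ((hinc S x i hx hu).1).elim
      · exact h.elim x
    rintro i ⟨p, x⟩ ⟨hx, hu⟩ ⟨p', x'⟩ ⟨hx', hu'⟩
    obtain ⟨s, h1, h2⟩ := hgen i p x hx hu
    obtain ⟨s', h1', h2'⟩ := hgen i p' x' hx' hu'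
    -- The !-boxes containing the vertex `i` determine the level that owns it, and only one
    -- production creates the vertices of that level.
    obtain rfl : s = s' := eq_of_atLevel_iff fun b => (h2 b).symm.trans (h2' b)
    obtain rfl := 𝒯.gen_unique s p p' h1 h1'
    rcases hshape p with ⟨Y, O, rel, ⟨S⟩⟩ | h
    · obtain ⟨_, rfl⟩ := hinc S x i hx hu
      obtain ⟨_, rfl⟩ := hinc S x' i hx' hu'
      rfl
    · exact h.elim x

end Traversal

end BangGraph

/-! ### Depth-first traversal of an instance -/

namespace BangGraph

/-- The levels that are reached by descending from the outermost level. -/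
inductive IsReachedLevel (H : BangGraph) : Option H.Box → Prop
  | none : IsReachedLevel H none
  | child (s : Option H.Box) (d : H.Box) : H.IsReachedLevel s → H.Child s d →
      H.IsReachedLevel (some d)

namespace Traversal

variable {H : BangGraph} {𝒢 : EdNCE VKind Unit} {K : KGraph}

/-- A stage of a depth-first traversal of the instance `K`, with the open copies of !-boxes given
by `s` and `f`. -/
structure Tour (𝒯 : Traversal H 𝒢) (I : Instantiation H K)
    (X : EGraph (VKind ⊕ 𝒢.NT) (Unit ⊕ 𝒢.NF)) (s : Option H.Box) (f : H.Box → ℕ) where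
  R : Rep H 𝒯.α X (𝒯.st s) s f
  φ : R.T → K.V
  π_eq : ∀ t, I.π (φ t) = R.π t
  ix_eq : ∀ t b, R.π t ∈ H.content b → I.ix (φ t) b = R.ix t b
  /-- A copy of a !-box with both visited and unvisited vertices is open. -/
  isOpen : ∀ x ∉ Set.range φ, ∀ t b, I.π x ∈ H.content b → R.π t ∈ H.content b →
    (∀ c, b ≤ c → I.ix x c = R.ix t c) → H.AtLevel s b ∧ ∀ c, b ≤ c → I.ix x c = f c
  visited : ∀ x, H.Live s f (I.π x) (I.ix x) → x ∈ Set.range φ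
  reached : H.IsReachedLevel s

variable {𝒯 : Traversal H 𝒢} {I : Instantiation H K}
  {X : EGraph (VKind ⊕ 𝒢.NT) (Unit ⊕ 𝒢.NF)} {s : Option H.Box} {f : H.Box → ℕ}

/-- The number of unvisited vertices. -/
noncomputable def Tour.remaining (C : 𝒯.Tour I X s f) : ℕ := (Set.range C.φ)ᶜ.ncard

/-- The first production creates the vertices outside all !-boxes. For these saturation of `I` asks
nothing, and it provides the matching vertices of `K`. -/
theorem exists_tour_init (𝒯 : Traversal H 𝒢) (I : Instantiation H K) :
    ∃ X f, 𝒢.Derives X ∧ Nonempty (𝒯.Tour I X none f) := by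
  obtain ⟨p, hp, ⟨S⟩⟩ := 𝒯.exists_gen none
  let R₀ := Rep.single 𝒯.α (𝒯.op none) none fun _ => 0
  have hder : 𝒢.Derives ((EGraph.single (Sum.inr (𝒯.op none))).subst (R₀.e none) (𝒢.rhs p)) := by
    refine EdNCE.Derives.step _ _ p ?_ (by rw [R₀.lab_nt, hp])
    have := EdNCE.Derives.start (𝒢 := 𝒢)
    rwa [𝒯.start] at this
  have hno : ∀ v ∈ H.own none, ∀ b, v ∉ H.content b := fun v hv b hb => (hv b).1 hb
  have hex : ∀ v : H.own none, ∃ x, I.π x = v.1 := fun v =>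
    (I.sat v.1 (fun _ => 0) fun b hb => (hno v.1 v.2 b hb).elim).imp fun _ h => h.1
  choose y hy using hex
  refine ⟨_, _, hder, ⟨⟨R₀.gen S fun t => t.elim, Sum.elim Empty.elim y, ?_, ?_, ?_, ?_, .none⟩⟩⟩
  · rintro (t | t)
    · exact t.elim
    · exact hy t
  · rintro (t | t) b hb
    · exact t.elim
    · exact (hno t.1 t.2 b hb).elim
  · rintro x - (t | t) b - hb
    · exact t.elim
    · exact (hno t.1 t.2 b hb).elim
  · intro x hx
    have hx' : I.π x ∈ H.own none := fun b => ⟨fun hb => (hx b hb).1, fun h => h.elim⟩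
    refine ⟨Sum.inr ⟨I.π x, hx'⟩, I.inj _ _ (hy ⟨I.π x, hx'⟩) fun b hb => ?_⟩
    have hb' : I.π (y ⟨I.π x, hx'⟩) ∈ H.content b := hb
    rw [hy] at hb'
    exact absurd hb' (hno _ hx' b)

/-- Below an open copy of a !-box with an unvisited vertex there is a next !-box to be opened. -/
theorem Tour.exists_child (hH : H.NoOverlap) (C : 𝒯.Tour I X s f) {x : K.V}
    (hx : x ∉ Set.range C.φ) (hs : ∀ b, H.AtLevel s b → I.π x ∈ H.content b ∧ I.ix x b = f b) :
    ∃ d, H.Child s d ∧ I.π x ∈ H.content d := by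
  have := H.finite_Box
  obtain ⟨b, hb, hbs⟩ : ∃ b, I.π x ∈ H.content b ∧ ¬ H.AtLevel s b := by
    by_contra hcon
    push Not at hcon
    exact hx (C.visited x fun b hb => ⟨hcon b hb, (hs b (hcon b hb)).2⟩)
  obtain ⟨d, -, ⟨hd, hds⟩, hmax⟩ := exists_maximal_ge_of_wellFoundedGT
    (fun b => I.π x ∈ H.content b ∧ ¬ H.AtLevel s b) b ⟨hb, hbs⟩
  refine ⟨d, ⟨hds, fun e => ⟨fun he => ?_, ?_⟩⟩, hd⟩
  · by_contra hcon
    push Not at hcon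
    exact hcon.1 (le_antisymm (hmax ⟨H.mono d e he hd, hcon.2⟩ he) he)
  · rintro (rfl | he)
    · exact le_rfl
    · by_contra hde
      have hed : ¬ e ≤ d := fun h => hds (he.mono h)
      exact hH d e ⟨hde, hed, _, hd, (hs e he).1⟩

/-- The copy of `d` to be entered is the one containing `x`. It is untouched: a visited vertex in
it, together with the unvisited `x`, would by `isOpen` make it open already. Its own vertices are
found in `K` by saturation of `I`, since all copies around `x` exist. -/
theorem Tour.exists_descend (hX : 𝒢.Derives X) (C : 𝒯.Tour I X s f) {x : K.V}
    (hx : x ∉ Set.range C.φ) (hs : ∀ b, H.AtLevel s b → I.π x ∈ H.content b ∧ I.ix x b = f b)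
    {d : H.Box} (hd : H.Child s d) (hxd : I.π x ∈ H.content d) :
    ∃ X', 𝒢.Derives X' ∧ ∃ C' : 𝒯.Tour I X' (some d) (I.ix x), Set.range C.φ ⊆ Set.range C'.φ := by
  obtain ⟨p, hp, ⟨S⟩⟩ := 𝒯.exists_call s d hd
  obtain ⟨q, hq, ⟨S'⟩⟩ := 𝒯.exists_gen (some d)
  have hfr : ∀ t, ¬ ∀ b, d ≤ b → C.R.π t ∈ H.content b ∧ C.R.ix t b = I.ix x b := fun t h =>
    hd.1 (C.isOpen x hx t d hxd (h d le_rfl).1 fun c hc => (h c hc).2.symm).1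
  let R₁ := C.R.call S hd (fun b hb => (hs b hb).2) hfr
  have hfr' : ∀ t, ¬ ∀ b, H.AtLevel (some d) b → R₁.π t ∈ H.content b ∧ R₁.ix t b = I.ix x b := by
    rintro (t | t)
    · exact hfr t
    · exact t.2.elim
  have hder : 𝒢.Derives ((X.subst (C.R.e none) (𝒢.rhs p)).subst (R₁.e none) (𝒢.rhs q)) :=
    EdNCE.Derives.step _ _ q (EdNCE.Derives.step _ _ p hX (by rw [C.R.lab_nt, hp]))
      (by rw [R₁.lab_nt, hq])
  have hex : ∀ v : H.own (some d), ∃ y, I.π y = v.1 ∧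
      ∀ b, v.1 ∈ H.content b → I.ix y b = I.ix x b := fun v =>
    I.sat v.1 (I.ix x) fun b hb => I.mem x b (H.mono d b ((v.2 b).1 hb) hxd)
  choose y hy hyi using hex
  refine ⟨_, hder, ⟨R₁.gen S' hfr', Sum.elim (Sum.elim C.φ fun v => v.2.elim) y, ?_, ?_, ?_, ?_,
    .child s d C.reached hd⟩, ?_⟩
  · rintro ((t | t) | t)
    · exact C.π_eq t
    · exact t.2.elim
    · exact hy t
  · rintro ((t | t) | t) b hb
    · exact C.ix_eq t b hb
    · exact t.2.elim
    · exact hyi t b hb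
  · rintro z hz ((t | t) | t) b hzb htb h
    · obtain ⟨h1, h2⟩ := C.isOpen z (fun ⟨u, hu⟩ => hz ⟨Sum.inl (Sum.inl u), hu⟩) t b hzb htb h
      refine ⟨(hd.2 b).2 (Or.inr h1), fun c hc => (h2 c hc).trans (hs c (h1.mono hc)).2.symm⟩
    · exact t.2.elim
    · exact ⟨(t.2 b).1 htb, h⟩
  · intro z hz
    by_cases hzd : I.π z ∈ H.content d
    · have hz' : I.π z ∈ H.own (some d) :=
        fun b => ⟨fun hb => (hz b hb).1, fun hb => H.mono d b hb hzd⟩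
      refine ⟨Sum.inr ⟨I.π z, hz'⟩, I.inj _ _ (hy ⟨I.π z, hz'⟩) fun b hb => ?_⟩
      have hb' : I.π z ∈ H.content b := by
        have h1 : I.π (y ⟨I.π z, hz'⟩) ∈ H.content b := hb
        rwa [hy] at h1
      exact (hyi ⟨I.π z, hz'⟩ b hb').trans (hz b hb').2.symm
    · obtain ⟨t, ht⟩ := C.visited z fun b hb => by
        have h1 := ((hd.2 b).1 (hz b hb).1).resolve_left fun h => hzd (h ▸ hb)
        exact ⟨h1, (hz b hb).2.trans (hs b h1).2⟩
      exact ⟨Sum.inl (Sum.inl t), ht⟩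
  · rintro _ ⟨t, rfl⟩
    exact ⟨Sum.inl (Sum.inl t), rfl⟩

/-- A copy may be closed only when it is completely visited, as in `hC`; otherwise it would be a
closed copy with visited and unvisited vertices, violating `isOpen`. No vertex is created, so the
progress made is kept. -/
theorem Tour.exists_close {d : H.Box} (hX : 𝒢.Derives X) (C : 𝒯.Tour I X (some d) f)
    (hC : ∀ x, (∀ b, d ≤ b → I.π x ∈ H.content b ∧ I.ix x b = f b) → x ∈ Set.range C.φ)
    (hd : H.Child s d) (hs : H.IsReachedLevel s) :
    ∃ X', 𝒢.Derives X' ∧ ∃ C' : 𝒯.Tour I X' s f, C'.remaining = C.remaining := by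
  obtain ⟨p, hp, ⟨S⟩⟩ := 𝒯.exists_close s d hd
  have hrange : Set.range (Sum.elim C.φ fun v : (∅ : Set H.graph.V) => v.2.elim) =
      Set.range C.φ := by
    ext z
    constructor
    · rintro ⟨t | t, rfl⟩
      · exact ⟨t, rfl⟩
      · exact t.2.elim
    · rintro ⟨t, rfl⟩
      exact ⟨Sum.inl t, rfl⟩
  refine ⟨_, EdNCE.Derives.step _ _ p hX (by rw [C.R.lab_nt, hp]),
    ⟨C.R.close S hd (𝒯.rel_out d) (𝒯.rel_in d), Sum.elim C.φ fun v => v.2.elim, ?_, ?_, ?_, ?_, hs⟩,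
    ?_⟩
  · rintro (t | t)
    · exact C.π_eq t
    · exact t.2.elim
  · rintro (t | t) b hb
    · exact C.ix_eq t b hb
    · exact t.2.elim
  · rintro z hz (t | t) b hzb htb h
    · have hz' : z ∉ Set.range C.φ := fun ⟨u, hu⟩ => hz ⟨Sum.inl u, hu⟩
      obtain ⟨h1, h2⟩ := C.isOpen z hz' t b hzb htb h
      refine ⟨((hd.2 b).1 h1).resolve_left ?_, h2⟩
      rintro rfl
      exact hz' (hC z fun c hc => ⟨H.mono _ _ hc hzb, h2 c hc⟩)
    · exact t.2.elim
  · intro z hz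
    obtain ⟨t, ht⟩ := C.visited z fun b hb => ⟨(hd.2 b).2 (Or.inr (hz b hb).1), (hz b hb).2⟩
    exact ⟨Sum.inl t, ht⟩
  · exact congrArg (fun S : Set K.V => Sᶜ.ncard) hrange

/-- The walk descends towards `x`. Each step opens one more !-box around `x`, and once all of them
are open `x` has been visited, so the descent terminates with fewer unvisited vertices. -/
theorem Tour.exists_visit (hH : H.NoOverlap) (x : K.V) (n : ℕ) :
    ∀ {X s f}, 𝒢.Derives X → ∀ C : 𝒯.Tour I X s f, x ∉ Set.range C.φ →
      (∀ b, H.AtLevel s b → I.π x ∈ H.content b ∧ I.ix x b = f b) →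
      {b | I.π x ∈ H.content b ∧ ¬ H.AtLevel s b}.ncard = n →
      ∃ X' s' f', 𝒢.Derives X' ∧ ∃ C' : 𝒯.Tour I X' s' f', C'.remaining < C.remaining := by
  have := K.finite_V
  have := H.finite_Box
  induction n using Nat.strong_induction_on with
  | _ n ih =>
  intro X s f hX C hx hs hn
  obtain ⟨d, hd, hxd⟩ := C.exists_child hH hx hs
  obtain ⟨X', hX', C', hC'⟩ := C.exists_descend hX hx hs hd hxd
  have hle : C'.remaining ≤ C.remaining :=
    Set.ncard_le_ncard (Set.compl_subset_compl.2 hC') (Set.toFinite _)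
  by_cases hx' : x ∈ Set.range C'.φ
  · exact ⟨X', _, _, hX', C', Set.ncard_lt_ncard
      ⟨Set.compl_subset_compl.2 hC', fun h => h hx hx'⟩ (Set.toFinite _)⟩
  · have hlt : {b | I.π x ∈ H.content b ∧ ¬ H.AtLevel (some d) b}.ncard < n := by
      rw [← hn]
      refine Set.ncard_lt_ncard ⟨fun b hb => ⟨hb.1, fun h => hb.2 ((hd.2 b).2 (Or.inr h))⟩, ?_⟩
        (Set.toFinite _)
      exact fun h => (h (⟨hxd, hd.1⟩ : d ∈ {b | _ ∧ _})).2 (le_refl d)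
    obtain ⟨X'', s'', f'', hX'', C'', hC''⟩ := ih _ hlt hX' C' hx'
      (fun b hb => ⟨H.mono d b hb hxd, rfl⟩) rfl
    exact ⟨X'', s'', f'', hX'', C'', hC''.trans_le hle⟩

/-- Either another vertex can be visited, or the traversal returns to the outermost level with all
vertices visited. -/
theorem Tour.exists_progress (hH : H.NoOverlap) (hs : H.IsReachedLevel s) :
    ∀ {X f}, 𝒢.Derives X → ∀ C : 𝒯.Tour I X s f,
      (∃ X' s' f', 𝒢.Derives X' ∧ ∃ C' : 𝒯.Tour I X' s' f', C'.remaining < C.remaining) ∨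
      ∃ X' f', 𝒢.Derives X' ∧ ∃ C' : 𝒯.Tour I X' none f', Set.range C'.φ = Set.univ := by
  induction hs with
  | none =>
    intro X f hX C
    by_cases h : ∃ x, x ∉ Set.range C.φ
    · obtain ⟨x, hx⟩ := h
      exact Or.inl (Tour.exists_visit hH x _ hX C hx (fun b hb => hb.elim) rfl)
    · push Not at h
      exact Or.inr ⟨X, f, hX, C, Set.eq_univ_of_forall h⟩
  | child s d hs hd ih =>
    intro X f hX C
    -- Either the current copy still has an unvisited vertex to descend to, or it is exhausted and
    -- can be closed.
    by_cases h : ∃ x, (∀ b, d ≤ b → I.π x ∈ H.content b ∧ I.ix x b = f b) ∧ x ∉ Set.range C.φ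
    · obtain ⟨x, hx, hx'⟩ := h
      exact Or.inl (Tour.exists_visit hH x _ hX C hx' hx rfl)
    · push Not at h
      obtain ⟨X', hX', C', hC'⟩ := C.exists_close hX h hd hs
      rw [← hC']
      exact ih hX' C'

theorem Tour.exists_complete (hH : H.NoOverlap) (n : ℕ) :
    ∀ {X s f}, 𝒢.Derives X → ∀ C : 𝒯.Tour I X s f, C.remaining = n →
      ∃ X' f', 𝒢.Derives X' ∧ ∃ C' : 𝒯.Tour I X' none f', Set.range C'.φ = Set.univ := by
  induction n using Nat.strong_induction_on with
  | _ n ih =>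
  intro X s f hX C hn
  rcases C.exists_progress hH C.reached hX with ⟨X', s', f', hX', C', hC'⟩ | h
  · exact ih _ (hn ▸ hC') hX' C' rfl
  · exact h

/-- At the end of a complete tour, generated nodes correspond bijectively to the vertices of `K`:
injectivity comes from `inj`, since copies with the same original and the same numbers coincide. -/
theorem mem_language_of_isInstance (hH : H.NoOverlap) (𝒯 : Traversal H 𝒢)
    (hK : H.IsInstance K) : K ∈ 𝒢.language := by
  obtain ⟨I⟩ := hK
  obtain ⟨X₀, f₀, hX₀, ⟨C₀⟩⟩ := exists_tour_init 𝒯 I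
  obtain ⟨X, f, hX, C, hC⟩ := C₀.exists_complete hH _ hX₀ rfl
  obtain ⟨p, hp, hD⟩ := 𝒯.exists_final
  obtain ⟨ψ, hlab, hE⟩ := C.R.exists_final hD
  have hφ : Function.Bijective C.φ := by
    refine ⟨fun t u h => C.R.inj t u ?_ fun b hb => ?_, Set.range_eq_univ.1 hC⟩
    · rw [← C.π_eq, ← C.π_eq, h]
    · rw [← C.ix_eq t b hb, h, C.ix_eq]
      rwa [← C.π_eq, ← h, C.π_eq]
  let e := ψ.symm.trans (Equiv.ofBijective C.φ hφ)
  have he : ∀ t, e (ψ t) = C.φ t := fun t => congrArg C.φ (ψ.symm_apply_apply t)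
  refine ⟨_, EdNCE.Derives.step _ _ p hX (by rw [C.R.lab_nt, hp]), e, ?_, ?_⟩
  · intro x
    obtain ⟨t, rfl⟩ := ψ.surjective x
    refine Eq.trans ?_ (hlab t).symm
    change Sum.inl (K.lab (e (ψ t))) = _
    rw [he, I.lab, C.π_eq]
  · intro x γ y
    obtain ⟨t, rfl⟩ := ψ.surjective x
    obtain ⟨u, rfl⟩ := ψ.surjective y
    refine Iff.trans ?_ (hE t γ u).symm
    change (∃ l, γ = Sum.inl l ∧ K.E (e (ψ t)) l (e (ψ u))) ↔ _
    rw [he, he]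
    have h1 := I.edge (C.φ t) (C.φ u)
    rw [C.π_eq, C.π_eq] at h1
    have h2 : K.E (C.φ t) () (C.φ u) ↔ H.graph.E (C.R.π t) () (C.R.π u) ∧
        ∀ b, C.R.π t ∈ H.content b → C.R.π u ∈ H.content b → C.R.ix t b = C.R.ix u b := by
      rw [h1]
      refine and_congr Iff.rfl (forall_congr' fun b => forall_congr' fun ht =>
        forall_congr' fun hu => ?_)
      rw [C.ix_eq t b ht, C.ix_eq u b hu]
    rw [← h2]
    constructor
    · rintro ⟨⟨⟩, h, h'⟩
      exact ⟨h, h'⟩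
    · rintro ⟨h, h'⟩
      exact ⟨(), h, h'⟩

theorem language_eq (hH : H.NoOverlap) (𝒯 : Traversal H 𝒢) : 𝒢.language = H.language := by
  ext K
  rw [mem_language_iff]
  exact ⟨isInstance_of_mem_language hH 𝒯, mem_language_of_isInstance hH 𝒯⟩

end Traversal

end BangGraph

/-! ### The grammar of a described !-graph -/

namespace BangCode

def hasEdge (c : BangCode) (i j : ℕ) : Bool := decide ((i, j) ∈ c.edges)

def isInside (c : BangCode) (a v : ℕ) : Bool := decide ((a, v) ∈ c.inside)

/-- Levels are described by `0` (the outermost level) and `b + 1`, for a !-box `b`. -/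
def atLevel (c : BangCode) (s e : ℕ) : Bool := s != 0 && decide ((s - 1, e) ∈ c.order)

def isChild (c : BangCode) (s d : ℕ) : Bool :=
  (d != 0 && !c.atLevel s (d - 1)) &&
    (List.range c.boxCount).all fun e => c.atLevel d e == (e == d - 1 || c.atLevel s e)

def ownList (c : BangCode) (s : ℕ) : List ℕ :=
  (List.range c.kinds.length).filter fun v =>
    (List.range c.boxCount).all fun e => c.isInside e v == c.atLevel s e

/-- The new label, after a copy of the !-box `d` is closed. -/
def relabel (c : BangCode) (d v : ℕ) : ℕ :=
  -- The number `kinds.idxOf false` is the first wire-vertex, whose label creates no edges. It fails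
  -- to be less than the length only if there are no wire-vertices, in which case there are no edges
  -- to prevent.
  bif c.isInside (d - 1) v && decide (c.kinds.idxOf false < c.kinds.length) then
    c.kinds.idxOf false else v

/-- The created vertices are numbered by their positions in `O`, and the nonterminal node comes
last, as number `O.length`. -/
def rhsEdges (c : BangCode) (O : List ℕ) : List (ℕ × Option ℕ × ℕ) :=
  (List.range O.length).flatMap fun i =>
    (i, some (O.getD i 0), O.length) :: (O.length, some (O.getD i 0), i) ::
      ((List.range O.length).filter fun j => c.hasEdge (O.getD i 0) (O.getD j 0)).map
        fun j => (i, none, j)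

/-- Productions are numbered by triples `(k, s, d)`: for `k = 0` the vertices of the level `s` are
created, for `k = 1` a copy of the !-box `d` below `s` is opened, for `k = 2` it is closed, and
`(3, 0, 0)` is the final production. -/
def isTag (c : BangCode) (t : ℕ × ℕ × ℕ) : Bool :=
  bif t.1 == 3 then t.2.1 == 0 && t.2.2 == 0 else
    bif t.1 == 0 then t.2.2 == 0 else c.isChild t.2.1 t.2.2

def tagOwn (c : BangCode) (t : ℕ × ℕ × ℕ) : List ℕ := bif t.1 == 0 then c.ownList t.2.1 else []

def tagRel (c : BangCode) (t : ℕ × ℕ × ℕ) (v : ℕ) : ℕ :=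
  bif t.1 == 2 then c.relabel t.2.2 v else v

/-- Odd numbers `2 * s + 1` are the nonterminals before, even numbers `2 * s` those after the
creation of the vertices of the level `s`. The final production falls under the last case and gets
`0`, the outermost level after creation. -/
def tagLhs (t : ℕ × ℕ × ℕ) : ℕ :=
  bif t.1 == 0 then 2 * t.2.1 + 1 else bif t.1 == 1 then 2 * t.2.1 else 2 * t.2.2

def tagRhs (t : ℕ × ℕ × ℕ) : ℕ :=
  bif t.1 == 1 then 2 * t.2.2 + 1 else 2 * t.2.1

/-- The test on `kinds` lets only labels of node-vertices produce edges to created nodes; this makes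
the labels of wire-vertices inert. -/
def tagConns (c : BangCode) (t : ℕ × ℕ × ℕ) :
    List ((Bool ⊕ ℕ) × Option ℕ × Option ℕ × ℕ × Bool) :=
  (List.range c.kinds.length).flatMap fun i => [true, false].flatMap fun σ =>
    [true, false].flatMap fun d =>
      (Sum.inl σ, some i, some (c.tagRel t i), (c.tagOwn t).length, d) ::
        ((List.range (c.tagOwn t).length).filter fun j => c.kinds.getD i false &&
          bif d then c.hasEdge i ((c.tagOwn t).getD j 0)
          else c.hasEdge ((c.tagOwn t).getD j 0) i).map
            fun j => (Sum.inl σ, some i, none, j, d)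

def tagLabels (c : BangCode) (t : ℕ × ℕ × ℕ) : List (Bool ⊕ ℕ) :=
  bif t.1 == 3 then [] else
    (c.tagOwn t).map (fun v => Sum.inl (c.kinds.getD v false)) ++ [Sum.inr (tagRhs t)]

def tagProd (c : BangCode) (t : ℕ × ℕ × ℕ) : ProdCode :=
  ⟨tagLhs t, c.tagLabels t, c.rhsEdges (c.tagOwn t), c.tagConns t⟩

def tags (c : BangCode) : List (ℕ × ℕ × ℕ) :=
  (List.range 4 ×ˢ (List.range (c.boxCount + 1) ×ˢ List.range (c.boxCount + 1))).filter c.isTag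

/-- The start `1` is the odd nonterminal of level `0`, and `2 * boxCount + 1` is the largest
nonterminal number in use. -/
def toGrammar (c : BangCode) : GrammarCode :=
  ⟨2 * c.boxCount + 1, c.kinds.length, 1, c.tags.map c.tagProd⟩

/-! ### The grammar depends primitive recursively on the description -/

section Computability

open Primrec

variable {A B : Type*} [Primcodable A] [Primcodable B]

/-- Filtering is a `flatMap` into singletons and empty lists. -/
theorem primrec_filter {f : A → List B} {p : A → B → Bool} (hf : Primrec f) (hp : Primrec₂ p) :
    Primrec fun a => (f a).filter (p a) :=
  (list_flatMap hf (Primrec.cond hp (list_cons.comp snd (const [])) (const [])).to₂).of_eq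
    fun a => by
      induction f a with
      | nil => rfl
      | cons b l ih => cases h : p a b <;> simp_all

/-- A test holds throughout a list when filtering by it preserves the length. -/
theorem primrec_all {f : A → List B} {p : A → B → Bool} (hf : Primrec f) (hp : Primrec₂ p) :
    Primrec fun a => (f a).all (p a) :=
  (Primrec.beq.comp (list_length.comp (primrec_filter hf hp)) (list_length.comp hf)).of_eq
    fun a => by
      rw [Bool.eq_iff_iff]
      simp

/-- Membership is detected by `idxOf` falling short of the length. -/
theorem primrec_mem [DecidableEq B] {f : A → B} {l : A → List B}
    [∀ a, Decidable (f a ∈ l a)] (hf : Primrec f) (hl : Primrec l) : Primrec fun a => decide (f a ∈ l a) :=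
  (Primrec.nat_lt.decide.comp (list_idxOf.comp hf hl) (list_length.comp hl)).of_eq
    fun a => by simp [List.idxOf_lt_length_iff]

theorem primrec_equiv : Primrec BangCode.equiv := Primrec.of_equiv

theorem primrec_kinds : Primrec BangCode.kinds := fst.comp primrec_equiv

theorem primrec_edges : Primrec BangCode.edges := fst.comp (snd.comp primrec_equiv)

theorem primrec_boxCount : Primrec BangCode.boxCount :=
  fst.comp (snd.comp (snd.comp primrec_equiv))

theorem primrec_order : Primrec BangCode.order :=
  fst.comp (snd.comp (snd.comp (snd.comp primrec_equiv)))

theorem primrec_inside : Primrec BangCode.inside :=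
  snd.comp (snd.comp (snd.comp (snd.comp primrec_equiv)))

variable {c : A → BangCode} {i j : A → ℕ} {O : A → List ℕ} {t : A → ℕ × ℕ × ℕ}

theorem primrec_hasEdge (hc : Primrec c) (hi : Primrec i) (hj : Primrec j) :
    Primrec fun a => (c a).hasEdge (i a) (j a) :=
  primrec_mem (Primrec.pair hi hj) (primrec_edges.comp hc)

theorem primrec_isInside (hc : Primrec c) (hi : Primrec i) (hj : Primrec j) :
    Primrec fun a => (c a).isInside (i a) (j a) :=
  primrec_mem (Primrec.pair hi hj) (primrec_inside.comp hc)

theorem primrec_atLevel (hc : Primrec c) (hi : Primrec i) (hj : Primrec j) :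
    Primrec fun a => (c a).atLevel (i a) (j a) :=
  Primrec.and.comp (Primrec.not.comp (Primrec.beq.comp hi (const 0)))
    (primrec_mem (Primrec.pair (pred.comp hi) hj) (primrec_order.comp hc))

theorem primrec_isChild (hc : Primrec c) (hi : Primrec i) (hj : Primrec j) :
    Primrec fun a => (c a).isChild (i a) (j a) :=
  Primrec.and.comp
    (Primrec.and.comp (Primrec.not.comp (Primrec.beq.comp hj (const 0)))
      (Primrec.not.comp (primrec_atLevel hc hi (pred.comp hj))))
    (primrec_all (list_range.comp (primrec_boxCount.comp hc))
      (Primrec.beq.comp (primrec_atLevel (hc.comp fst) (hj.comp fst) snd)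
        (Primrec.or.comp (Primrec.beq.comp snd (pred.comp (hj.comp fst)))
          (primrec_atLevel (hc.comp fst) (hi.comp fst) snd))).to₂)

theorem primrec_ownList (hc : Primrec c) (hi : Primrec i) :
    Primrec fun a => (c a).ownList (i a) :=
  primrec_filter (list_range.comp (list_length.comp (primrec_kinds.comp hc)))
    (primrec_all (list_range.comp (primrec_boxCount.comp (hc.comp fst)))
      (Primrec.beq.comp (primrec_isInside (hc.comp (fst.comp fst)) snd (snd.comp fst))
        (primrec_atLevel (hc.comp (fst.comp fst)) (hi.comp (fst.comp fst)) snd)).to₂).to₂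

theorem primrec_relabel (hc : Primrec c) (hi : Primrec i) (hj : Primrec j) :
    Primrec fun a => (c a).relabel (i a) (j a) :=
  have h : Primrec fun a => (c a).kinds.idxOf false :=
    list_idxOf.comp (const false) (primrec_kinds.comp hc)
  Primrec.cond (Primrec.and.comp (primrec_isInside hc (pred.comp hi) hj)
    (Primrec.nat_lt.decide.comp h (list_length.comp (primrec_kinds.comp hc)))) h hj

theorem primrec_rhsEdges (hc : Primrec c) (hO : Primrec O) :
    Primrec fun a => (c a).rhsEdges (O a) :=
  have hl : Primrec fun a => (O a).length := list_length.comp hO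
  have hg : Primrec fun p : A × ℕ => (O p.1).getD p.2 0 :=
    (list_getD 0).comp (hO.comp fst) snd
  list_flatMap (list_range.comp hl)
    (list_cons.comp (Primrec.pair snd (Primrec.pair (option_some.comp hg) (hl.comp fst)))
      (list_cons.comp (Primrec.pair (hl.comp fst) (Primrec.pair (option_some.comp hg) snd))
        (list_map (primrec_filter (list_range.comp (hl.comp fst))
          (primrec_hasEdge (hc.comp (fst.comp fst)) (hg.comp fst)
            (hg.comp (Primrec.pair (fst.comp fst) snd))).to₂)
          (Primrec.pair (snd.comp fst) (Primrec.pair (const none) snd)).to₂))).to₂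

theorem primrec_isTag (hc : Primrec c) (ht : Primrec t) : Primrec fun a => (c a).isTag (t a) :=
  have h1 := fst.comp ht
  have h2 := fst.comp (snd.comp ht)
  have h3 := snd.comp (snd.comp ht)
  Primrec.cond (Primrec.beq.comp h1 (const 3))
    (Primrec.and.comp (Primrec.beq.comp h2 (const 0)) (Primrec.beq.comp h3 (const 0)))
    (Primrec.cond (Primrec.beq.comp h1 (const 0)) (Primrec.beq.comp h3 (const 0))
      (primrec_isChild hc h2 h3))

theorem primrec_tagOwn (hc : Primrec c) (ht : Primrec t) : Primrec fun a => (c a).tagOwn (t a) :=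
  Primrec.cond (Primrec.beq.comp (fst.comp ht) (const 0))
    (primrec_ownList hc (fst.comp (snd.comp ht))) (const [])

theorem primrec_tagRel (hc : Primrec c) (ht : Primrec t) (hi : Primrec i) :
    Primrec fun a => (c a).tagRel (t a) (i a) :=
  Primrec.cond (Primrec.beq.comp (fst.comp ht) (const 2))
    (primrec_relabel hc (snd.comp (snd.comp ht)) hi) hi

theorem primrec_tagLhs : Primrec tagLhs :=
  have h2 : Primrec fun t : ℕ × ℕ × ℕ => 2 * t.2.1 := nat_mul.comp (const 2) (fst.comp snd)
  have h3 : Primrec fun t : ℕ × ℕ × ℕ => 2 * t.2.2 := nat_mul.comp (const 2) (snd.comp snd)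
  Primrec.cond (Primrec.beq.comp fst (const 0)) (succ.comp h2)
    (Primrec.cond (Primrec.beq.comp fst (const 1)) h2 h3)

theorem primrec_tagRhs : Primrec tagRhs :=
  have h2 : Primrec fun t : ℕ × ℕ × ℕ => 2 * t.2.1 := nat_mul.comp (const 2) (fst.comp snd)
  have h3 : Primrec fun t : ℕ × ℕ × ℕ => 2 * t.2.2 := nat_mul.comp (const 2) (snd.comp snd)
  Primrec.cond (Primrec.beq.comp fst (const 1)) (succ.comp h3) h2

theorem primrec_tagConns (hc : Primrec c) (ht : Primrec t) :
    Primrec fun a => (c a).tagConns (t a) :=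
  have hO := primrec_tagOwn hc ht
  have hl : Primrec fun a => ((c a).tagOwn (t a)).length := list_length.comp hO
  have ha : Primrec fun p : ((A × ℕ) × Bool) × Bool => p.1.1.1 := fst.comp (fst.comp fst)
  have hi : Primrec fun p : ((A × ℕ) × Bool) × Bool => p.1.1.2 := snd.comp (fst.comp fst)
  have hσ : Primrec fun p : ((A × ℕ) × Bool) × Bool => p.1.2 := snd.comp fst
  have hg : Primrec fun p : (((A × ℕ) × Bool) × Bool) × ℕ =>
      ((c p.1.1.1.1).tagOwn (t p.1.1.1.1)).getD p.2 0 :=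
    (list_getD 0).comp (hO.comp (ha.comp fst)) snd
  list_flatMap (list_range.comp (list_length.comp (primrec_kinds.comp hc)))
    (list_flatMap (const [true, false]) (list_flatMap (const [true, false])
      (list_cons.comp
        (Primrec.pair (sumInl.comp hσ) (Primrec.pair (option_some.comp hi)
          (Primrec.pair (option_some.comp (primrec_tagRel (hc.comp ha) (ht.comp ha) hi))
            (Primrec.pair (hl.comp ha) snd))))
        (list_map (primrec_filter (list_range.comp (hl.comp ha))
          (Primrec.and.comp
            ((list_getD false).comp (primrec_kinds.comp (hc.comp (ha.comp fst))) (hi.comp fst))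
            (Primrec.cond (snd.comp fst)
              (primrec_hasEdge (hc.comp (ha.comp fst)) (hi.comp fst) hg)
              (primrec_hasEdge (hc.comp (ha.comp fst)) hg (hi.comp fst)))).to₂)
          (Primrec.pair (sumInl.comp (hσ.comp fst)) (Primrec.pair (option_some.comp (hi.comp fst))
            (Primrec.pair (const none) (Primrec.pair snd (snd.comp fst))))).to₂)).to₂).to₂).to₂

theorem primrec_tagLabels (hc : Primrec c) (ht : Primrec t) :
    Primrec fun a => (c a).tagLabels (t a) :=
  Primrec.cond (Primrec.beq.comp (fst.comp ht) (const 3)) (const [])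
    (list_append.comp
      (list_map (primrec_tagOwn hc ht)
        (sumInl.comp ((list_getD false).comp (primrec_kinds.comp (hc.comp fst)) snd)).to₂)
      (list_cons.comp (sumInr.comp (primrec_tagRhs.comp ht)) (const [])))

theorem primrec_tagProd (hc : Primrec c) (ht : Primrec t) :
    Primrec fun a => (c a).tagProd (t a) :=
  (Primrec.of_equiv_symm (e := ProdCode.equiv)).comp
    (Primrec.pair (primrec_tagLhs.comp ht) (Primrec.pair (primrec_tagLabels hc ht)
      (Primrec.pair (primrec_rhsEdges hc (primrec_tagOwn hc ht)) (primrec_tagConns hc ht))))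

theorem primrec_tags : Primrec tags :=
  have hr : Primrec fun c : BangCode => List.range (c.boxCount + 1) :=
    list_range.comp (succ.comp primrec_boxCount)
  have h2 : Primrec fun c : BangCode =>
      List.range (c.boxCount + 1) ×ˢ List.range (c.boxCount + 1) :=
    list_flatMap hr (list_map (hr.comp fst) (Primrec.pair (snd.comp fst) snd).to₂).to₂
  have h3 : Primrec fun c : BangCode =>
      List.range 4 ×ˢ (List.range (c.boxCount + 1) ×ˢ List.range (c.boxCount + 1)) :=
    list_flatMap (const (List.range 4))
      (list_map (h2.comp fst) (Primrec.pair (snd.comp fst) snd).to₂).to₂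
  primrec_filter h3 (primrec_isTag fst snd).to₂

theorem primrec_toGrammar : Primrec toGrammar :=
  (Primrec.of_equiv_symm (e := GrammarCode.equiv)).comp
    (Primrec.pair (succ.comp (nat_mul.comp (const 2) primrec_boxCount))
      (Primrec.pair (list_length.comp primrec_kinds) (Primrec.pair (const 1)
        (list_map primrec_tags (primrec_tagProd fst snd).to₂))))

end Computability

end BangCode

/-! ### The grammar computed from a description is a traversal -/

namespace BangCode

theorem mem_rhsEdges (c : BangCode) (O : List ℕ) (i j : ℕ) (γ : Option ℕ) :
    (i, γ, j) ∈ c.rhsEdges O ↔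
      (i < O.length ∧ γ = some (O.getD i 0) ∧ j = O.length) ∨
      (i = O.length ∧ γ = some (O.getD j 0) ∧ j < O.length) ∨
      (i < O.length ∧ γ = none ∧ j < O.length ∧ c.hasEdge (O.getD i 0) (O.getD j 0)) := by
  simp only [rhsEdges, List.mem_flatMap, List.mem_range, List.mem_cons, List.mem_map,
    List.mem_filter, Prod.mk.injEq]
  constructor
  · rintro ⟨k, hk, ⟨rfl, rfl, rfl⟩ | ⟨rfl, rfl, rfl⟩ | ⟨l, ⟨hl, hE⟩, rfl, rfl, rfl⟩⟩
    · exact Or.inl ⟨hk, rfl, rfl⟩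
    · exact Or.inr (Or.inl ⟨rfl, rfl, hk⟩)
    · exact Or.inr (Or.inr ⟨hk, rfl, hl, hE⟩)
  · rintro (⟨hk, rfl, rfl⟩ | ⟨rfl, rfl, hk⟩ | ⟨hk, rfl, hl, hE⟩)
    · exact ⟨i, hk, Or.inl ⟨rfl, rfl, rfl⟩⟩
    · exact ⟨j, hk, Or.inr (Or.inl ⟨rfl, rfl, rfl⟩)⟩
    · exact ⟨i, hk, Or.inr (Or.inr ⟨j, ⟨hl, hE⟩, rfl, rfl, rfl⟩)⟩

theorem mem_tagConns (c : BangCode) (t : ℕ × ℕ × ℕ) (σ d : Bool) (i j : ℕ) (γ : Option ℕ)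
    (hi : i < c.kinds.length) :
    (Sum.inl σ, some i, γ, j, d) ∈ c.tagConns t ↔
      (γ = some (c.tagRel t i) ∧ j = (c.tagOwn t).length) ∨
      (γ = none ∧ j < (c.tagOwn t).length ∧ c.kinds.getD i false = true ∧
        (bif d then c.hasEdge i ((c.tagOwn t).getD j 0)
          else c.hasEdge ((c.tagOwn t).getD j 0) i) = true) := by
  simp only [tagConns, List.mem_flatMap, List.mem_range, List.mem_cons, List.mem_map,
    List.mem_filter, Prod.mk.injEq, Bool.and_eq_true]
  constructor
  · rintro ⟨i', hi', σ', -, d', -, ⟨h1, h2, rfl, rfl, rfl⟩ | ⟨k, ⟨hk, hn, hE⟩, h1, h2, rfl, rfl, rfl⟩⟩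
    · cases h1; cases h2
      exact Or.inl ⟨rfl, rfl⟩
    · cases h1; cases h2
      exact Or.inr ⟨rfl, hk, hn, hE⟩
  · rintro (⟨rfl, rfl⟩ | ⟨rfl, hk, hn, hE⟩)
    · exact ⟨i, hi, σ, by cases σ <;> simp, d, by cases d <;> simp, Or.inl ⟨rfl, rfl, rfl, rfl, rfl⟩⟩
    · exact ⟨i, hi, σ, by cases σ <;> simp, d, by cases d <;> simp,
        Or.inr ⟨j, ⟨hk, hn, hE⟩, rfl, rfl, rfl, rfl, rfl⟩⟩

theorem tagOwn_nodup (c : BangCode) (t : ℕ × ℕ × ℕ) : (c.tagOwn t).Nodup := by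
  unfold tagOwn
  cases t.1 == 0
  · exact List.nodup_nil
  · exact List.nodup_range.filter _

theorem lt_of_mem_tagOwn {c : BangCode} {t : ℕ × ℕ × ℕ} {v : ℕ} (h : v ∈ c.tagOwn t) :
    v < c.kinds.length := by
  unfold tagOwn at h
  cases h0 : t.1 == 0
  · simp [h0] at h
  · simp only [h0, cond_true, ownList, List.mem_filter, List.mem_range] at h
    exact h.1

theorem relabel_lt (c : BangCode) (d v : ℕ) (hv : v < c.kinds.length) :
    c.relabel d v < c.kinds.length := by
  unfold relabel
  cases h : c.isInside (d - 1) v && decide (c.kinds.idxOf false < c.kinds.length)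
  · exact hv
  · simp only [Bool.and_eq_true, decide_eq_true_eq] at h
    exact h.2

/-- A numbering of the vertices and !-boxes of `H` by which `c` describes `H`. -/
structure Encoding (c : BangCode) (H : BangGraph) where
  e : Fin c.kinds.length ≃ H.graph.V
  d : Fin c.boxCount ≃ H.Box
  lab : ∀ i, H.graph.lab (e i) = VKind.ofBool (c.kinds.get i)
  edge : ∀ i j, H.graph.E (e i) () (e j) ↔ (i.val, j.val) ∈ c.edges
  order : ∀ a b, d a ≤ d b ↔ (a.val, b.val) ∈ c.order
  inside : ∀ a i, e i ∈ H.content (d a) ↔ (a.val, i.val) ∈ c.inside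

namespace Encoding

variable {c : BangCode} {H : BangGraph} (ε : c.Encoding H)

def vtx (v : H.graph.V) : ℕ := (ε.e.symm v).val

def box (b : H.Box) : ℕ := (ε.d.symm b).val

def level : Option H.Box → ℕ
  | none => 0
  | some b => ε.box b + 1

theorem vtx_lt (v : H.graph.V) : ε.vtx v < c.kinds.length := (ε.e.symm v).2

theorem box_lt (b : H.Box) : ε.box b < c.boxCount := (ε.d.symm b).2

theorem vtx_inj {v w : H.graph.V} (h : ε.vtx v = ε.vtx w) : v = w :=
  ε.e.symm.injective (Fin.ext h)

theorem box_inj {a b : H.Box} (h : ε.box a = ε.box b) : a = b :=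
  ε.d.symm.injective (Fin.ext h)

theorem exists_vtx {i : ℕ} (h : i < c.kinds.length) : ∃ v, ε.vtx v = i :=
  ⟨ε.e ⟨i, h⟩, by simp [vtx]⟩

theorem exists_box {a : ℕ} (h : a < c.boxCount) : ∃ b, ε.box b = a :=
  ⟨ε.d ⟨a, h⟩, by simp [box]⟩

theorem level_lt (s : Option H.Box) : ε.level s < c.boxCount + 1 := by
  cases s with
  | none => exact Nat.succ_pos _
  | some b => exact Nat.succ_lt_succ (ε.box_lt b)

theorem level_inj {s s' : Option H.Box} (h : ε.level s = ε.level s') : s = s' := by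
  rcases s with _ | b <;> rcases s' with _ | b'
  · rfl
  · cases h
  · cases h
  · exact congrArg some (ε.box_inj (Nat.succ.inj h))

theorem exists_level {n : ℕ} (h : n < c.boxCount + 1) : ∃ s, ε.level s = n := by
  cases n with
  | zero => exact ⟨none, rfl⟩
  | succ n =>
    obtain ⟨b, rfl⟩ := ε.exists_box (Nat.lt_of_succ_lt_succ h)
    exact ⟨some b, rfl⟩

theorem hasEdge_iff (v w : H.graph.V) :
    c.hasEdge (ε.vtx v) (ε.vtx w) = true ↔ H.graph.E v () w := by
  have := ε.edge (ε.e.symm v) (ε.e.symm w)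
  rw [ε.e.apply_symm_apply, ε.e.apply_symm_apply] at this
  rw [this]
  exact decide_eq_true_iff

theorem isInside_iff (b : H.Box) (v : H.graph.V) :
    c.isInside (ε.box b) (ε.vtx v) = true ↔ v ∈ H.content b := by
  have := ε.inside (ε.d.symm b) (ε.e.symm v)
  rw [ε.e.apply_symm_apply, ε.d.apply_symm_apply] at this
  rw [this]
  exact decide_eq_true_iff

theorem lab_eq (v : H.graph.V) :
    H.graph.lab v = VKind.ofBool (c.kinds.getD (ε.vtx v) false) := by
  have := ε.lab (ε.e.symm v)
  rw [ε.e.apply_symm_apply] at this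
  rw [this, List.getD_eq_getElem _ _ (ε.vtx_lt v)]
  rfl

theorem lab_eq_node_iff (v : H.graph.V) :
    H.graph.lab v = VKind.node ↔ c.kinds.getD (ε.vtx v) false = true := by
  rw [ε.lab_eq]
  cases c.kinds.getD (ε.vtx v) false <;> simp [VKind.ofBool]

theorem atLevel_iff (s : Option H.Box) (b : H.Box) :
    c.atLevel (ε.level s) (ε.box b) = true ↔ H.AtLevel s b := by
  cases s with
  | none => simp [atLevel, level, BangGraph.AtLevel]
  | some a =>
    have := ε.order (ε.d.symm a) (ε.d.symm b)
    rw [ε.d.apply_symm_apply, ε.d.apply_symm_apply] at this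
    refine Iff.trans ?_ this.symm
    simp [atLevel, level, box]

theorem all_box_iff (p : ℕ → Bool) :
    (List.range c.boxCount).all p = true ↔ ∀ b, p (ε.box b) = true := by
  rw [List.all_eq_true]
  constructor
  · exact fun h b => h _ (List.mem_range.2 (ε.box_lt b))
  · intro h a ha
    obtain ⟨b, rfl⟩ := ε.exists_box (List.mem_range.1 ha)
    exact h b

theorem isChild_iff (s : Option H.Box) (d : H.Box) :
    c.isChild (ε.level s) (ε.level (some d)) = true ↔ H.Child s d := by
  have h1 : ε.level (some d) - 1 = ε.box d := rfl
  have h2 : (ε.level (some d) != 0) = true := by simp [level]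
  rw [isChild, h1, h2, Bool.true_and, Bool.and_eq_true, Bool.not_eq_true', ← Bool.not_eq_true,
    ε.atLevel_iff, ε.all_box_iff]
  refine and_congr Iff.rfl (forall_congr' fun e => ?_)
  rw [beq_iff_eq, Bool.eq_iff_iff, ε.atLevel_iff, Bool.or_eq_true, ε.atLevel_iff, beq_iff_eq]
  have h3 : ε.box e = ε.box d ↔ e = d := ⟨ε.box_inj, congrArg _⟩
  rw [h3]
  rfl

theorem mem_ownList_iff (s : Option H.Box) (v : H.graph.V) :
    ε.vtx v ∈ c.ownList (ε.level s) ↔ v ∈ H.own s := by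
  rw [ownList, List.mem_filter, List.mem_range, and_iff_right (ε.vtx_lt v), ε.all_box_iff]
  refine forall_congr' fun b => ?_
  rw [beq_iff_eq, Bool.eq_iff_iff, ε.isInside_iff, ε.atLevel_iff]

/-- The change of labels when a copy of `d` is closed. -/
def rel (d : H.Box) (v : H.graph.V) : H.graph.V :=
  ε.e ⟨c.relabel (ε.level (some d)) (ε.vtx v), c.relabel_lt _ _ (ε.vtx_lt v)⟩

theorem vtx_rel (d : H.Box) (v : H.graph.V) :
    ε.vtx (ε.rel d v) = c.relabel (ε.level (some d)) (ε.vtx v) := by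
  simp [vtx, rel]

theorem rel_out (d : H.Box) (v : H.graph.V) (hv : v ∉ H.content d) : ε.rel d v = v := by
  apply ε.vtx_inj
  rw [← ε.isInside_iff, Bool.not_eq_true] at hv
  rw [vtx_rel, relabel, show ε.level (some d) - 1 = ε.box d from rfl, hv]
  rfl

/-- If a wire-vertex exists, the new label is one, so the premise of inertness fails. If none
exists, its conclusion holds for every vertex. -/
theorem rel_in (d : H.Box) (v : H.graph.V) (hv : v ∈ H.content d) : H.Inert (ε.rel d v) := by
  rw [← ε.isInside_iff] at hv
  intro hn w
  rw [ε.lab_eq_node_iff] at hn ⊢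
  rw [vtx_rel, relabel, show ε.level (some d) - 1 = ε.box d from rfl, hv, Bool.true_and] at hn
  by_cases h : c.kinds.idxOf false < c.kinds.length
  · rw [decide_eq_true h, cond_true, List.getD_eq_getElem _ _ h, List.getElem_idxOf] at hn
    cases hn
  · rw [List.idxOf_lt_length_iff] at h
    rw [List.getD_eq_getElem _ _ (ε.vtx_lt w)]
    by_contra hw
    rw [Bool.not_eq_true] at hw
    exact h (hw ▸ List.getElem_mem _)

/-- The edge labels. -/
def edgeLabel (v : H.graph.V) : Fin c.kinds.length := ε.e.symm v

/-- The nonterminal with a given number. -/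
def nonterminal (c : BangCode) (n : ℕ) : Fin (2 * c.boxCount + 1 + 1) := Fin.ofNat _ n

/-- The reduction of nonterminal numbers modulo their count has no effect on the numbers in use. -/
theorem nonterminal_inj {n m : ℕ} (hn : n < 2 * c.boxCount + 2) (hm : m < 2 * c.boxCount + 2)
    (h : nonterminal c n = nonterminal c m) : n = m := by
  have h1 := congrArg Fin.val h
  change n % (2 * c.boxCount + 2) = m % (2 * c.boxCount + 2) at h1
  rwa [Nat.mod_eq_of_lt hn, Nat.mod_eq_of_lt hm] at h1

/-- All productions but the final one share one layout and differ only in the list of created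
vertices, the relabelling and the nonterminals. The node bijection sends a created vertex to its
position in the list, which is well defined as the list has no repetitions, and the nonterminal node
to the position after the end. -/
theorem nonempty_shape (t : ℕ × ℕ × ℕ) (ht : t.1 ≠ 3) (O : Set H.graph.V)
    (hO : ∀ v, v ∈ O ↔ ε.vtx v ∈ c.tagOwn t) (rel : H.graph.V → H.graph.V)
    (hrel : ∀ v, ε.vtx (rel v) = c.tagRel t (ε.vtx v)) :
    Nonempty (BangGraph.Shape H ε.edgeLabel
      ((c.tagProd t).graph (2 * c.boxCount + 1) c.kinds.length)
      (nonterminal c (tagRhs t)) O rel) := by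
  have hlab : c.tagLabels t = (c.tagOwn t).map (fun v => Sum.inl (c.kinds.getD v false)) ++
      [Sum.inr (tagRhs t)] := by
    rw [tagLabels, beq_false_of_ne ht]
    rfl
  have hlen : (c.tagProd t).labels.length = (c.tagOwn t).length + 1 := by
    change (c.tagLabels t).length = _
    rw [hlab]
    simp
  let pos : O → ℕ := fun v => (c.tagOwn t).idxOf (ε.vtx v.1)
  have hpos : ∀ v, pos v < (c.tagOwn t).length := fun v =>
    List.idxOf_lt_length_iff.2 ((hO v.1).1 v.2)
  have hget : ∀ v, (c.tagOwn t).getD (pos v) 0 = ε.vtx v.1 := fun v => by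
    rw [List.getD_eq_getElem _ _ (hpos v), List.getElem_idxOf]
  have hposinj : ∀ v w, pos v = pos w → v = w := fun v w h =>
    Subtype.ext (ε.vtx_inj (by rw [← hget, ← hget, h]))
  have hposex : ∀ i < (c.tagOwn t).length, ∃ v, pos v = i := by
    intro i hi
    have hmem := List.getElem_mem hi
    obtain ⟨v, hv⟩ := ε.exists_vtx (lt_of_mem_tagOwn hmem)
    refine ⟨⟨v, (hO v).2 (hv ▸ hmem)⟩, ?_⟩
    change (c.tagOwn t).idxOf (ε.vtx v) = i
    rw [hv]
    exact (c.tagOwn_nodup t).idxOf_getElem i hi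
  let num : Option O → ℕ := fun x => x.elim (c.tagOwn t).length pos
  have hnum : ∀ x, num x < (c.tagProd t).labels.length := by
    rw [hlen]
    rintro (_ | v)
    · exact Nat.lt_succ_self _
    · exact (hpos v).trans (Nat.lt_succ_self _)
  have hbij : Function.Bijective fun x => (⟨num x, hnum x⟩ : Fin (c.tagProd t).labels.length) := by
    constructor
    · rintro (_ | v) (_ | w) h
      · rfl
      · exact absurd (congrArg Fin.val h) (hpos w).ne'
      · exact absurd (congrArg Fin.val h) (hpos v).ne
      · exact congrArg some (hposinj v w (congrArg Fin.val h))
    · rintro ⟨i, hi⟩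
      rcases (Nat.lt_succ_iff.1 (hlen ▸ hi)).lt_or_eq with h | h
      · obtain ⟨v, hv⟩ := hposex i h
        exact ⟨some v, Fin.ext hv⟩
      · exact ⟨none, Fin.ext h.symm⟩
  have hγ : ∀ (γ : Unit ⊕ Fin c.kinds.length) (v : H.graph.V),
      edgeLabelCode γ = some (ε.vtx v) ↔ γ = Sum.inr (ε.edgeLabel v) := by
    rintro (_ | i) v
    · simp [edgeLabelCode]
    · refine ⟨fun h => congrArg Sum.inr (Fin.ext (Option.some.inj h)), fun h => ?_⟩
      rw [Sum.inr.inj h]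
      rfl
  have hγ0 : ∀ γ : Unit ⊕ Fin c.kinds.length, edgeLabelCode γ = none ↔ γ = Sum.inl () := by
    rintro (_ | i) <;> simp [edgeLabelCode]
  refine ⟨⟨Equiv.ofBijective _ hbij, ?_, ?_, ?_, ?_, ?_, ?_, ?_, ?_⟩⟩
  · change nodeLabelOf _ ((c.tagLabels t).get ⟨(c.tagOwn t).length, _⟩) = _
    have : (c.tagLabels t).get ⟨(c.tagOwn t).length, hnum none⟩ = Sum.inr (tagRhs t) := by
      simp [hlab]
    rw [this]
    rfl
  · intro v
    change nodeLabelOf _ ((c.tagLabels t).get ⟨pos v, _⟩) = _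
    have : (c.tagLabels t).get ⟨pos v, hnum (some v)⟩ =
        Sum.inl (c.kinds.getD (ε.vtx v.1) false) := by
      rw [← hget v, List.getD_eq_getElem _ 0 (hpos v)]
      simp only [hlab, List.get_eq_getElem]
      rw [List.getElem_append_left (by simpa using hpos v), List.getElem_map]
    rw [this, ε.lab_eq]
    rfl
  · intro v γ w
    have hmem := c.mem_rhsEdges (c.tagOwn t) (pos v) (pos w) (edgeLabelCode γ)
    rw [hget, hget, ε.hasEdge_iff] at hmem
    change _ ∧ (pos v, edgeLabelCode γ, pos w) ∈ c.rhsEdges (c.tagOwn t) ↔ _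
    rw [hmem, ← hγ0]
    constructor
    · rintro ⟨-, h | h | h⟩
      · exact absurd h.2.2 (hpos w).ne
      · exact absurd h.1 (hpos v).ne
      · exact ⟨h.2.1, h.2.2.2⟩
    · rintro ⟨h1, h2⟩
      -- The inequality of ends demanded in decoding edges costs nothing, because the graph of `H`
      -- has no self-loops.
      refine ⟨fun h => ?_, Or.inr (Or.inr ⟨hpos v, h1, hpos w, h2⟩)⟩
      have := hposinj v w (congrArg Fin.val h)
      rw [this] at h2
      exact H.graph.irrefl _ _ h2
  · intro v γ
    have hmem := c.mem_rhsEdges (c.tagOwn t) (pos v) (c.tagOwn t).length (edgeLabelCode γ)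
    rw [hget, hγ] at hmem
    change _ ∧ (pos v, edgeLabelCode γ, (c.tagOwn t).length) ∈ c.rhsEdges (c.tagOwn t) ↔ _
    rw [hmem]
    constructor
    · rintro ⟨-, h | h | h⟩
      · exact h.2.1
      · exact absurd h.1 (hpos v).ne
      · exact absurd h.2.2.1 (lt_irrefl _)
    · intro h
      exact ⟨fun h => (hpos v).ne (congrArg Fin.val h), Or.inl ⟨hpos v, h, rfl⟩⟩
  · intro v γ
    have hmem := c.mem_rhsEdges (c.tagOwn t) (c.tagOwn t).length (pos v) (edgeLabelCode γ)
    rw [hget, hγ] at hmem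
    change _ ∧ ((c.tagOwn t).length, edgeLabelCode γ, pos v) ∈ c.rhsEdges (c.tagOwn t) ↔ _
    rw [hmem]
    constructor
    · rintro ⟨-, h | h | h⟩
      · exact absurd h.1 (lt_irrefl _)
      · exact h.2.1
      · exact absurd h.1 (lt_irrefl _)
    · intro h
      exact ⟨fun h => (hpos v).ne' (congrArg Fin.val h), Or.inr (Or.inl ⟨rfl, h, hpos v⟩)⟩
  · intro σ i γ d
    have hmem := c.mem_tagConns t σ.toBool d.toBool (ε.vtx i) (c.tagOwn t).length
      (edgeLabelCode γ) (ε.vtx_lt i)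
    rw [← hrel, hγ] at hmem
    refine hmem.trans ⟨?_, fun h => Or.inl ⟨h, rfl⟩⟩
    rintro (h | h)
    · exact h.1
    · exact absurd h.2.1 (lt_irrefl _)
  · intro σ i γ v
    have hmem := c.mem_tagConns t σ.toBool true (ε.vtx i) (pos v) (edgeLabelCode γ) (ε.vtx_lt i)
    rw [hget, ← ε.lab_eq_node_iff, hγ0, cond_true, ε.hasEdge_iff] at hmem
    refine hmem.trans ⟨?_, fun h => Or.inr ⟨h.1, hpos v, h.2⟩⟩
    rintro (h | h)
    · exact absurd h.2 (hpos v).ne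
    · exact ⟨h.1, h.2.2⟩
  · intro σ i γ v
    have hmem := c.mem_tagConns t σ.toBool false (ε.vtx i) (pos v) (edgeLabelCode γ) (ε.vtx_lt i)
    rw [hget, ← ε.lab_eq_node_iff, hγ0, cond_false, ε.hasEdge_iff] at hmem
    refine hmem.trans ⟨?_, fun h => Or.inr ⟨h.1, hpos v, h.2⟩⟩
    rintro (h | h)
    · exact absurd h.2 (hpos v).ne
    · exact ⟨h.1, h.2.2⟩

/-- The triple that numbers a production. -/
def tagOf (p : c.toGrammar.grammar.Prd) : ℕ × ℕ × ℕ :=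
  c.tags.get (Fin.cast (List.length_map _) p)

theorem tagOf_mem (p : c.toGrammar.grammar.Prd) : tagOf p ∈ c.tags := List.get_mem _ _

theorem get_eq (p : c.toGrammar.grammar.Prd) :
    c.toGrammar.prods.get p = c.tagProd (tagOf p) := by
  exact List.getElem_map _

theorem lhs_eq (p : c.toGrammar.grammar.Prd) :
    c.toGrammar.grammar.lhs p = nonterminal c (tagLhs (tagOf p)) := by
  change Fin.ofNat _ (c.toGrammar.prods.get p).lhs = _
  rw [get_eq]
  rfl

theorem rhs_eq (p : c.toGrammar.grammar.Prd) : c.toGrammar.grammar.rhs p =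
    (c.tagProd (tagOf p)).graph (2 * c.boxCount + 1) c.kinds.length := by
  change (c.toGrammar.prods.get p).graph _ _ = _
  rw [get_eq]
  rfl

theorem tagOf_inj {p q : c.toGrammar.grammar.Prd} (h : tagOf p = tagOf q) : p = q := by
  have hn : c.tags.Nodup := (List.nodup_range.product (List.nodup_range.product
    List.nodup_range)).filter _
  exact Fin.cast_injective _ (List.nodup_iff_injective_get.1 hn h)

theorem exists_tagOf {t : ℕ × ℕ × ℕ} (h : t ∈ c.tags) :
    ∃ p : c.toGrammar.grammar.Prd, tagOf p = t := by
  obtain ⟨i, hi⟩ := List.mem_iff_get.1 h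
  exact ⟨Fin.cast (List.length_map _).symm i, hi⟩

/-- Numbers up to `boxCount` are exactly the numbers of levels, so the tests on numbers in `isTag`
translate into the relation between a level and a child. -/
theorem mem_tags_iff (t : ℕ × ℕ × ℕ) : t ∈ c.tags ↔
    (∃ s, t = (0, ε.level s, 0)) ∨
    (∃ s d, H.Child s d ∧ t = (1, ε.level s, ε.level (some d))) ∨
    (∃ s d, H.Child s d ∧ t = (2, ε.level s, ε.level (some d))) ∨ t = (3, 0, 0) := by
  obtain ⟨k, s, d⟩ := t
  rw [tags, List.mem_filter, List.mem_product, List.mem_product, List.mem_range,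
    List.mem_range, List.mem_range]
  constructor
  · rintro ⟨⟨hk, hs, hd⟩, h⟩
    obtain ⟨s, rfl⟩ := ε.exists_level hs
    obtain ⟨d, rfl⟩ := ε.exists_level hd
    have hchild : c.isChild (ε.level s) (ε.level d) = true → ∃ d', d = some d' ∧ H.Child s d' := by
      intro h
      rcases d with _ | d
      · simp [isChild, level] at h
      · exact ⟨d, rfl, (ε.isChild_iff s d).1 h⟩
    interval_cases k
    · have : ε.level d = 0 := by simpa [isTag] using h
      exact Or.inl ⟨s, by rw [this]⟩
    · obtain ⟨d, rfl, hd'⟩ := hchild h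
      exact Or.inr (Or.inl ⟨s, d, hd', rfl⟩)
    · obtain ⟨d, rfl, hd'⟩ := hchild h
      exact Or.inr (Or.inr (Or.inl ⟨s, d, hd', rfl⟩))
    · have : ε.level s = 0 ∧ ε.level d = 0 := by simpa [isTag] using h
      exact Or.inr (Or.inr (Or.inr (by rw [this.1, this.2])))
  · have h0 : 0 < c.boxCount + 1 := Nat.succ_pos _
    rintro (⟨s, h⟩ | ⟨s, d, hd, h⟩ | ⟨s, d, hd, h⟩ | h) <;> cases h
    · exact ⟨⟨by norm_num, ε.level_lt s, h0⟩, rfl⟩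
    · exact ⟨⟨by norm_num, ε.level_lt s, ε.level_lt _⟩, (ε.isChild_iff s d).2 hd⟩
    · exact ⟨⟨by norm_num, ε.level_lt s, ε.level_lt _⟩, (ε.isChild_iff s d).2 hd⟩
    · exact ⟨⟨by norm_num, h0, h0⟩, rfl⟩

theorem shape_gen (s : Option H.Box) (p : c.toGrammar.grammar.Prd)
    (hp : tagOf p = (0, ε.level s, 0)) :
    Nonempty (BangGraph.Shape H ε.edgeLabel (c.toGrammar.grammar.rhs p)
      (nonterminal c (2 * ε.level s)) (H.own s) id) := by
  rw [rhs_eq, hp]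
  exact ε.nonempty_shape (0, ε.level s, 0) (by simp) _ (fun v => (ε.mem_ownList_iff s v).symm) _
    fun v => rfl

theorem shape_call (s : Option H.Box) (d : H.Box) (p : c.toGrammar.grammar.Prd)
    (hp : tagOf p = (1, ε.level s, ε.level (some d))) :
    Nonempty (BangGraph.Shape H ε.edgeLabel (c.toGrammar.grammar.rhs p)
      (nonterminal c (2 * ε.level (some d) + 1)) ∅ id) := by
  rw [rhs_eq, hp]
  exact ε.nonempty_shape (1, ε.level s, ε.level (some d)) (by simp) _
    (fun v => by simp [tagOwn]) _ fun v => rfl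

theorem shape_close (s : Option H.Box) (d : H.Box) (p : c.toGrammar.grammar.Prd)
    (hp : tagOf p = (2, ε.level s, ε.level (some d))) :
    Nonempty (BangGraph.Shape H ε.edgeLabel (c.toGrammar.grammar.rhs p)
      (nonterminal c (2 * ε.level s)) ∅ (ε.rel d)) := by
  rw [rhs_eq, hp]
  exact ε.nonempty_shape (2, ε.level s, ε.level (some d)) (by simp) _
    (fun v => by simp [tagOwn]) _ fun v => ε.vtx_rel d v

theorem isEmpty_rhs (p : c.toGrammar.grammar.Prd) (hp : tagOf p = (3, 0, 0)) :
    IsEmpty (c.toGrammar.grammar.rhs p).V := by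
  rw [rhs_eq, hp]
  exact inferInstanceAs (IsEmpty (Fin 0))

/-- The grammar of a description of `H` traverses `H`. -/
def traversal : BangGraph.Traversal H c.toGrammar.grammar where
  α := ε.edgeLabel
  op s := nonterminal c (2 * ε.level s + 1)
  st s := nonterminal c (2 * ε.level s)
  rel := ε.rel
  op_inj s s' h := by
    have h1 := ε.level_lt s
    have h2 := ε.level_lt s'
    have := nonterminal_inj (by omega) (by omega) h
    exact ε.level_inj (by omega)
  st_inj s s' h := by
    have h1 := ε.level_lt s
    have h2 := ε.level_lt s'
    have := nonterminal_inj (by omega) (by omega) h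
    exact ε.level_inj (by omega)
  op_ne_st s s' h := by
    have h1 := ε.level_lt s
    have h2 := ε.level_lt s'
    have := nonterminal_inj (by omega) (by omega) h
    omega
  rel_out := ε.rel_out
  rel_in := ε.rel_in
  start := rfl
  cases p := by
    rcases (ε.mem_tags_iff _).1 (tagOf_mem p) with ⟨s, h⟩ | ⟨s, d, hd, h⟩ | ⟨s, d, hd, h⟩ | h
    · exact Or.inl ⟨s, by rw [lhs_eq, h]; rfl, ε.shape_gen s p h⟩
    · exact Or.inr (Or.inl ⟨s, d, hd, by rw [lhs_eq, h]; rfl, ε.shape_call s d p h⟩)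
    · exact Or.inr (Or.inr (Or.inl ⟨s, d, hd, by rw [lhs_eq, h]; rfl, ε.shape_close s d p h⟩))
    · exact Or.inr (Or.inr (Or.inr ⟨by rw [lhs_eq, h]; rfl, isEmpty_rhs p h⟩))
  exists_gen s := by
    obtain ⟨p, h⟩ := exists_tagOf ((ε.mem_tags_iff _).2 (Or.inl ⟨s, rfl⟩))
    exact ⟨p, by rw [lhs_eq, h]; rfl, ε.shape_gen s p h⟩
  exists_call s d hd := by
    obtain ⟨p, h⟩ := exists_tagOf ((ε.mem_tags_iff _).2 (Or.inr (Or.inl ⟨s, d, hd, rfl⟩)))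
    exact ⟨p, by rw [lhs_eq, h]; rfl, ε.shape_call s d p h⟩
  exists_close s d hd := by
    obtain ⟨p, h⟩ := exists_tagOf ((ε.mem_tags_iff _).2 (Or.inr (Or.inr (Or.inl ⟨s, d, hd, rfl⟩))))
    exact ⟨p, by rw [lhs_eq, h]; rfl, ε.shape_close s d p h⟩
  exists_final := by
    obtain ⟨p, h⟩ := exists_tagOf ((ε.mem_tags_iff _).2 (Or.inr (Or.inr (Or.inr rfl))))
    exact ⟨p, by rw [lhs_eq, h]; rfl, isEmpty_rhs p h⟩
  gen_unique s p q hp hq := by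
    -- Only productions creating the vertices of a level have an odd left-hand side, and the number
    -- determines the level.
    have key : ∀ p, c.toGrammar.grammar.lhs p = nonterminal c (2 * ε.level s + 1) →
        tagOf p = (0, ε.level s, 0) := by
      intro p hp
      have h1 := ε.level_lt s
      rw [lhs_eq] at hp
      rcases (ε.mem_tags_iff _).1 (tagOf_mem p) with ⟨s', h⟩ | ⟨s', d, -, h⟩ | ⟨s', d, -, h⟩ | h <;>
        rw [h] at hp ⊢
      · have h2 := ε.level_lt s'
        have : 2 * ε.level s' + 1 = 2 * ε.level s + 1 :=
          nonterminal_inj (by omega) (by omega) hp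
        rw [show ε.level s' = ε.level s by omega]
      · have h2 := ε.level_lt s'
        have : 2 * ε.level s' = 2 * ε.level s + 1 :=
          nonterminal_inj (by omega) (by omega) hp
        omega
      · have h2 := ε.level_lt (some d)
        have : 2 * ε.level (some d) = 2 * ε.level s + 1 :=
          nonterminal_inj (by omega) (by omega) hp
        omega
      · have : 0 = 2 * ε.level s + 1 := nonterminal_inj (by omega) (by omega) hp
        omega
    exact tagOf_inj ((key p hp).trans (key q hq).symm)
  final_unique p q hp hq := by
    -- Every other production has its nonterminal node on the right-hand side.
    have key : ∀ p, IsEmpty (c.toGrammar.grammar.rhs p).V → tagOf p = (3, 0, 0) := by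
      intro p hp
      rcases (ε.mem_tags_iff _).1 (tagOf_mem p) with ⟨s, h⟩ | ⟨s, d, -, h⟩ | ⟨s, d, -, h⟩ | h
      · obtain ⟨S⟩ := ε.shape_gen s p h
        exact hp.elim (S.g none)
      · obtain ⟨S⟩ := ε.shape_call s d p h
        exact hp.elim (S.g none)
      · obtain ⟨S⟩ := ε.shape_close s d p h
        exact hp.elim (S.g none)
      · exact h
    exact tagOf_inj ((key p hp).trans (key q hq).symm)

end Encoding

end BangCode

theorem mainTheorem2 :
    ∃ f : BangCode → GrammarCode, Computable f ∧
      ∀ H : BangGraph, H.NoOverlap → ∀ c : BangCode, c.Encodes H →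
        (f c).grammar.IsLinear ∧
        (f c).grammar.language = H.language ∧
        ∃ α : H.graph.V ↪ (f c).grammar.NF, (f c).grammar.IsBangLinear α := by
  refine ⟨BangCode.toGrammar, BangCode.primrec_toGrammar.to_comp, fun H hH c hc => ?_⟩
  obtain ⟨e, d, h1, h2, h3, h4⟩ := hc
  let ε : c.Encoding H := ⟨e, d, h1, h2, h3, h4⟩
  have hl := ε.traversal.isBangLinear hH ε.e.symm.toEmbedding fun _ => rfl
  exact ⟨hl.linear, ε.traversal.language_eq hH, _, hl⟩
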